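/- Let $n,e,f\ge 0$ be integers and $G=GL(n,\mathbb C)$. Let $V_0=M_n(\mathbb C)^{\oplus e}$ and $V_1=M_n(\mathbb C)^{\oplus f}$, with $G$ acting by simultaneous conjugation, and let $$S=S_{e,f,n}=S(V_0^*)\otimes\textstyle\bigwedge V_1^*$$ (symmetric algebra tensor exterior algebra), a supercommutative superalgebra on which $G$ acts by the algebra automorphisms extending the contragredient action on $V_0^*\oplus V_1^*$. Let $G$ act diagonally on $M_n(S)=M_n(\mathbb C)\otimes S$ (conjugation on $M_n(\mathbb C)$). Let $\eta_i=(\eta^{(i)}_{h,k})\in M_n(S)$, $1\le i\le e$, be the bosonic generic matrices and $\xi_j=(\xi^{(j)}_{h,k})\in M_n(S)$, $1\le j\le f$, the fermionic generic matrices, where $\eta^{(i)}_{h,k}\in V_0^*$ (even) and $\xi^{(j)}_{h,k}\in V_1^*$ (odd) are the coordinate functions of the $i$-th, resp. $j$-th, matrix. Write $tr:M_n(S)\to S$ for the usual trace. For the free superalgebra $R=\mathbb C\langle X,Y\rangle$ in even variables $y_1,\dots,y_e$ and odd variables $x_1,\dots,x_f$, let $[R,R]_s$ be the span of the supercommutators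 $ab-(-1)^{d(a)d(b)}ba$ of homogeneous elements, and let $\mathcal T$ be the super symmetric algebra of the superspace $W=R/[R,R]_s$, that is $\mathcal T=S(W_0)\otimes\bigwedge W_1$; the class of $M\in R$ in $\mathcal T$ is denoted $t(M)$. The free superalgebra with trace is the graded tensor product $\mathcal F_T\langle X,Y\rangle=R\,\widehat\otimes\,\mathcal T$. The evaluation $ev:\mathcal F_T\langle X,Y\rangle\to M_n(S)$ is the homomorphism with $y_i\mapsto\eta_i$, $x_j\mapsto\xi_j$ and $t(M)\mapsto tr(ev(M))\cdot 1$; it restricts to a homomorphism $\mathcal T\to S$, $t(M)\mapsto tr(ev(M))$, where $S$ is identified with the scalar matrices. Theorem (FFT). The image of $ev$ is the algebra $\mathcal E_n=M_n(S)^G$ of equivariant maps, and the image of its restriction $\mathcal T\to S$ is the algebra $\mathcal T_n=S^G$ of invariants. That is: (1) the algebra $\mathcal T_n=S^G$ is generated, as a $\mathbb C$-algebra, by the elements $tr(M)$ for all monomials $M$ in the generic matrices $\eta_i,\xi_j$; (2) the algebra $\mathcal E_n=M_n(S)^G$ is generated, as a $\mathbb C$-algebra, by the elements $tr(M)\cdot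 1$ for all monomials $M$, together with the generic matrices $\eta_i,\xi_j$. -/

import Mathlib

open scoped TensorProduct DirectSum

noncomputable section

/-! ### Superalgebras over the complex numbers

A superspace is given by its even and odd parts; a superalgebra is a complex algebra `A` together
with a `ZMod 2`-grading `𝒜 : ZMod 2 → Submodule ℂ A`. -/

/-- The super symmetric algebra `𝕂(W) = S(W₀) ⊗ ⋀ W₁` of a superspace `W = W₀ ⊕ W₁`.
Since `S(W₀)` is purely even, this is the ordinary tensor product of algebras. -/
abbrev SuperSym (W₀ W₁ : Type*) [AddCommGroup W₀] [Module ℂ W₀] [AddCommGroup W₁] [Module ℂ W₁] :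
    Type _ :=
  SymmetricAlgebra ℂ W₀ ⊗[ℂ] ExteriorAlgebra ℂ W₁

namespace SuperSym

variable (W₀ W₁ : Type*) [AddCommGroup W₀] [Module ℂ W₀] [AddCommGroup W₁] [Module ℂ W₁]

/-- The parity grading of `𝕂(W)`: degree `i` is `S(W₀) ⊗ (⋀ W₁)ᵢ`, where `(⋀ W₁)₀` and `(⋀ W₁)₁`
are spanned by the products of an even, respectively odd, number of elements of `W₁`. -/
def grading (i : ZMod 2) : Submodule ℂ (SuperSym W₀ W₁) :=
  ((CliffordAlgebra.evenOdd (0 : QuadraticForm ℂ W₁) i).baseChange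
    (SymmetricAlgebra ℂ W₀)).restrictScalars ℂ

instance gradedAlgebra : GradedAlgebra (grading W₀ W₁) :=
  let G : GradedAlgebra fun i => (CliffordAlgebra.evenOdd (0 : QuadraticForm ℂ W₁) i).baseChange
    (SymmetricAlgebra ℂ W₀) := inferInstance
  { one_mem := G.one_mem
    mul_mem := fun _ _ _ _ ha hb => G.mul_mem ha hb
    decompose' := G.decompose'
    left_inv := G.left_inv
    right_inv := G.right_inv }

/-- The generators of degree `0`. -/
def ιEven : W₀ →ₗ[ℂ] SuperSym W₀ W₁ :=
  (Algebra.TensorProduct.includeLeft : SymmetricAlgebra ℂ W₀ →ₐ[ℂ] SuperSym W₀ W₁).toLinearMap ∘ₗ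
    SymmetricAlgebra.ι ℂ W₀

/-- The generators of degree `1`. -/
def ιOdd : W₁ →ₗ[ℂ] SuperSym W₀ W₁ :=
  (Algebra.TensorProduct.includeRight : ExteriorAlgebra ℂ W₁ →ₐ[ℂ] SuperSym W₀ W₁).toLinearMap ∘ₗ
    ExteriorAlgebra.ι ℂ

variable {W₀ W₁}

theorem ιEven_mem (w : W₀) : ιEven W₀ W₁ w ∈ grading W₀ W₁ 0 :=
  Submodule.tmul_mem_baseChange_of_mem _
    (SetLike.GradedOne.one_mem (A := CliffordAlgebra.evenOdd (0 : QuadraticForm ℂ W₁)))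

theorem ιOdd_mem (w : W₁) : ιOdd W₀ W₁ w ∈ grading W₀ W₁ 1 :=
  Submodule.tmul_mem_baseChange_of_mem _
    (CliffordAlgebra.ι_mem_evenOdd_one (0 : QuadraticForm ℂ W₁) w)

end SuperSym

/-- A superalgebra is supercommutative if `ab = (-1)^{d(a)d(b)} ba` for homogeneous `a`, `b`. -/
def IsSuperComm {A : Type*} [Ring A] [Algebra ℂ A] (𝒜 : ZMod 2 → Submodule ℂ A) : Prop :=
  ∀ ⦃i j : ZMod 2⦄ ⦃a b : A⦄, a ∈ 𝒜 i → b ∈ 𝒜 j → a * b = (-1 : ℤˣ) ^ (i * j) • (b * a)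

theorem SuperSym.isSuperComm (W₀ W₁ : Type*) [AddCommGroup W₀] [Module ℂ W₀]
    [AddCommGroup W₁] [Module ℂ W₁] : IsSuperComm (SuperSym.grading W₀ W₁) := by
  intro i j a b ha hb
  have hΛ : ∀ x ∈ CliffordAlgebra.evenOdd (0 : QuadraticForm ℂ W₁) i,
      ∀ y ∈ CliffordAlgebra.evenOdd (0 : QuadraticForm ℂ W₁) j,
      x * y = (-1 : ℤˣ) ^ (i * j) • (y * x) := by
    intro x hx y hy
    have := CliffordAlgebra.map_mul_map_of_isOrtho_of_mem_evenOdd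
      (QuadraticMap.Isometry.id (0 : QuadraticForm ℂ W₁))
      (QuadraticMap.Isometry.id (0 : QuadraticForm ℂ W₁)) (by intro x y; simp [QuadraticMap.IsOrtho])
      x y hx hy
    simpa [mul_comm j i] using this
  change a ∈ Submodule.baseChange _ _ at ha
  change b ∈ Submodule.baseChange _ _ at hb
  rw [Submodule.baseChange_eq_span] at ha hb
  induction ha using Submodule.span_induction with
  | zero => simp
  | add x y _ _ hx hy => rw [add_mul, mul_add, smul_add, hx, hy]
  | smul s x _ hx =>
    rw [smul_mul_assoc, mul_smul_comm, hx, smul_comm]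
  | mem x hx =>
    obtain ⟨x, hx, rfl⟩ := hx
    induction hb using Submodule.span_induction with
    | zero => simp
    | add x y _ _ hx hy => rw [add_mul, mul_add, smul_add, hx, hy]
    | smul s x _ hx =>
      rw [smul_mul_assoc, mul_smul_comm, hx, smul_comm]
    | mem y hy =>
      obtain ⟨y, hy, rfl⟩ := hy
      simp only [TensorProduct.mk_apply, Algebra.TensorProduct.tmul_mul_tmul, one_mul]
      rw [hΛ x hx y hy, Units.smul_def, Units.smul_def, ← Int.cast_smul_eq_zsmul ℂ,
        ← Int.cast_smul_eq_zsmul ℂ, TensorProduct.tmul_smul]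

namespace IsSuperComm

variable {A : Type*} [Ring A] [Algebra ℂ A] {𝒜 : ZMod 2 → Submodule ℂ A} [GradedAlgebra 𝒜]

theorem even_mem_center (h : IsSuperComm 𝒜) {a : A} (ha : a ∈ 𝒜 0) :
    a ∈ Subalgebra.center ℂ A := by
  rw [Subalgebra.mem_center_iff]
  intro b
  induction b using DirectSum.Decomposition.inductionOn 𝒜 with
  | zero => simp
  | homogeneous b => simpa using (h ha b.2).symm
  | add x y hx hy => rw [add_mul, mul_add, hx, hy]

theorem odd_mul_self {A : Type*} [Ring A] [Algebra ℂ A] {𝒜 : ZMod 2 → Submodule ℂ A}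
    (h : IsSuperComm 𝒜) {a : A} (ha : a ∈ 𝒜 1) : a * a = 0 := by
  have h1 : a * a = -(a * a) := by simpa using h ha ha
  have h2 : (2 : ℂ) • (a * a) = 0 := by
    rw [two_smul]
    nth_rewrite 1 [h1]
    simp
  simpa using h2

end IsSuperComm

namespace SuperSym

section Lift

variable {W₀ W₁ A : Type*} [AddCommGroup W₀] [Module ℂ W₀] [AddCommGroup W₁] [Module ℂ W₁]
  [Ring A] [Algebra ℂ A] {𝒜 : ZMod 2 → Submodule ℂ A} [GradedAlgebra 𝒜] (h : IsSuperComm 𝒜)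
  (φ₀ : W₀ →ₗ[ℂ] 𝒜 0) (φ₁ : W₁ →ₗ[ℂ] 𝒜 1)

/-- The extension of `φ₀` to `S(W₀)`; even elements of `A` are central. -/
def liftEven : SymmetricAlgebra ℂ W₀ →ₐ[ℂ] Subalgebra.center ℂ A :=
  SymmetricAlgebra.lift <|
    LinearMap.codRestrict (Subalgebra.toSubmodule (Subalgebra.center ℂ A))
      ((𝒜 0).subtype ∘ₗ φ₀) fun w => h.even_mem_center (φ₀ w).2

/-- The extension of `φ₁` to `⋀ W₁`; odd elements of `A` have square zero. -/
def liftOdd : ExteriorAlgebra ℂ W₁ →ₐ[ℂ] A :=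
  ExteriorAlgebra.lift ℂ ⟨(𝒜 1).subtype ∘ₗ φ₁, fun w => h.odd_mul_self (φ₁ w).2⟩

theorem lift_commute (s : SymmetricAlgebra ℂ W₀) (l : ExteriorAlgebra ℂ W₁) :
    Commute ((Subalgebra.center ℂ A).val.comp (liftEven h φ₀) s) (liftOdd h φ₁ l) :=
  ((Subalgebra.mem_center_iff.1 (liftEven h φ₀ s).2) _).symm

/-- The algebra homomorphism `𝕂(W) → A` into a supercommutative superalgebra that extends a graded
linear map `W₀ → A₀`, `W₁ → A₁`. -/
def lift : SuperSym W₀ W₁ →ₐ[ℂ] A :=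
  Algebra.TensorProduct.lift ((Subalgebra.center ℂ A).val.comp (liftEven h φ₀)) (liftOdd h φ₁)
    (lift_commute h φ₀ φ₁)

theorem lift_tmul (s : SymmetricAlgebra ℂ W₀) (l : ExteriorAlgebra ℂ W₁) :
    lift h φ₀ φ₁ (s ⊗ₜ l) = (liftEven h φ₀ s : A) * liftOdd h φ₁ l := rfl

theorem lift_ιEven (w : W₀) : lift h φ₀ φ₁ (ιEven W₀ W₁ w) = φ₀ w := by
  refine (lift_tmul h φ₀ φ₁ _ _).trans ?_
  rw [map_one, mul_one, liftEven, SymmetricAlgebra.lift_ι_apply]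
  rfl

theorem lift_ιOdd (w : W₁) : lift h φ₀ φ₁ (ιOdd W₀ W₁ w) = φ₁ w := by
  refine (lift_tmul h φ₀ φ₁ _ _).trans ?_
  rw [map_one, liftOdd, ExteriorAlgebra.lift_ι_apply]
  exact one_mul _

end Lift

end SuperSym

theorem SuperSym.lift_mem {W₀ W₁ A : Type*} [AddCommGroup W₀] [Module ℂ W₀] [AddCommGroup W₁]
    [Module ℂ W₁] [Ring A] [Algebra ℂ A] {𝒜 : ZMod 2 → Submodule ℂ A} [GradedAlgebra 𝒜]
    (h : IsSuperComm 𝒜) (φ₀ : W₀ →ₗ[ℂ] 𝒜 0) (φ₁ : W₁ →ₗ[ℂ] 𝒜 1) {i : ZMod 2}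
    {x : SuperSym W₀ W₁} (hx : x ∈ SuperSym.grading W₀ W₁ i) :
    SuperSym.lift h φ₀ φ₁ x ∈ 𝒜 i := by
  have hS : ∀ s : SymmetricAlgebra ℂ W₀, SuperSym.lift h φ₀ φ₁ (s ⊗ₜ 1) ∈ 𝒜 0 := by
    intro s
    induction s using SymmetricAlgebra.induction with
    | algebraMap r =>
      have : (algebraMap ℂ (SymmetricAlgebra ℂ W₀) r ⊗ₜ[ℂ] (1 : ExteriorAlgebra ℂ W₁)) =
        algebraMap ℂ (SuperSym W₀ W₁) r := rfl
      rw [this, AlgHom.commutes]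
      exact SetLike.algebraMap_mem_graded 𝒜 r
    | ι w => exact (SuperSym.lift_ιEven h φ₀ φ₁ w) ▸ (φ₀ w).2
    | mul a b ha hb =>
      have := SetLike.mul_mem_graded ha hb
      rw [← map_mul, Algebra.TensorProduct.tmul_mul_tmul] at this
      simpa using this
    | add a b ha hb => rw [TensorProduct.add_tmul, map_add]; exact add_mem ha hb
  have hΛ : ∀ y ∈ CliffordAlgebra.evenOdd (0 : QuadraticForm ℂ W₁) i,
      SuperSym.lift h φ₀ φ₁ (1 ⊗ₜ y) ∈ 𝒜 i := by
    intro y hy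
    have hι : ∀ w : W₁, SuperSym.lift h φ₀ φ₁ (1 ⊗ₜ CliffordAlgebra.ι 0 w) ∈ 𝒜 1 := fun w =>
      (SuperSym.lift_ιOdd h φ₀ φ₁ w) ▸ (φ₁ w).2
    induction y, hy using CliffordAlgebra.evenOdd_induction with
    | range_ι_pow v hv =>
      fin_cases i
      · obtain ⟨r, rfl⟩ : ∃ r, algebraMap ℂ (CliffordAlgebra (0 : QuadraticForm ℂ W₁)) r = v := by
          simpa [ZMod.val, Submodule.mem_one] using hv
        have : ((1 : SymmetricAlgebra ℂ W₀) ⊗ₜ[ℂ] algebraMap ℂ (ExteriorAlgebra ℂ W₁) r) =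
          algebraMap ℂ (SuperSym W₀ W₁) r := (Algebra.TensorProduct.algebraMap_apply' r).symm
        erw [this, AlgHom.commutes]
        exact SetLike.algebraMap_mem_graded 𝒜 r
      · obtain ⟨w, rfl⟩ : ∃ w, CliffordAlgebra.ι (0 : QuadraticForm ℂ W₁) w = v := by
          simpa [ZMod.val] using hv
        exact hι w
    | add x y hx hy h1 h2 => rw [TensorProduct.tmul_add, map_add]; exact add_mem h1 h2
    | ι_mul_ι_mul m₁ m₂ x hx ih =>
      have := SetLike.mul_mem_graded (SetLike.mul_mem_graded (hι m₁) (hι m₂)) ih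
      simp only [← map_mul, Algebra.TensorProduct.tmul_mul_tmul, one_mul] at this
      have e : (1 : ZMod 2) + 1 = 0 := rfl
      simpa [e] using this
  change x ∈ Submodule.baseChange _ _ at hx
  rw [Submodule.baseChange_eq_span] at hx
  induction hx using Submodule.span_induction with
  | zero => simp
  | add x y _ _ hx hy => rw [map_add]; exact add_mem hx hy
  | smul s x _ hx =>
    have := SetLike.mul_mem_graded (hS s) hx
    rw [← map_mul, zero_add] at this
    have e : s • x = (s ⊗ₜ 1) * x := Algebra.smul_def s x
    rwa [e]
  | mem x hx =>
    obtain ⟨x, hx, rfl⟩ := hx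
    exact hΛ x hx

section FreeTrace

variable {A : Type*} [Ring A] [Algebra ℂ A] (𝒜 : ZMod 2 → Submodule ℂ A)

/-- The span `[A, A]ₛ` of the supercommutators `ab - (-1)^{d(a)d(b)} ba` of homogeneous elements. -/
def superCommutators : Submodule ℂ A :=
  Submodule.span ℂ {x | ∃ i j : ZMod 2, ∃ a ∈ 𝒜 i, ∃ b ∈ 𝒜 j,
    x = a * b - (-1 : ℤˣ) ^ (i * j) • (b * a)}

/-- The degree `i` part of the graded quotient `A / [A, A]ₛ`. -/
abbrev SuperCyclic (i : ZMod 2) : Type _ :=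
  𝒜 i ⧸ (superCommutators 𝒜).comap (𝒜 i).subtype

/-- The algebra `𝕂(A / [A, A]ₛ)` of formal traces of a superalgebra `A`. -/
abbrev TraceAlg : Type _ := SuperSym (SuperCyclic 𝒜 0) (SuperCyclic 𝒜 1)

variable [GradedAlgebra 𝒜]

/-- The formal trace `t : A → 𝕂(A / [A, A]ₛ)`: the class of an element in
`A / [A, A]ₛ = (A / [A, A]ₛ)₀ ⊕ (A / [A, A]ₛ)₁`. -/
def formalTrace : A →ₗ[ℂ] TraceAlg 𝒜 :=
  SuperSym.ιEven _ _ ∘ₗ Submodule.mkQ _ ∘ₗ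
      DirectSum.component ℂ (ZMod 2) (fun i => 𝒜 i) 0 ∘ₗ
        (DirectSum.decomposeLinearEquiv 𝒜).toLinearMap +
    SuperSym.ιOdd _ _ ∘ₗ Submodule.mkQ _ ∘ₗ
      DirectSum.component ℂ (ZMod 2) (fun i => 𝒜 i) 1 ∘ₗ
        (DirectSum.decomposeLinearEquiv 𝒜).toLinearMap

/-- The superalgebra with trace `A_t = A ⊗̂ 𝕂(A / [A, A]ₛ)` freely generated by a superalgebra `A`;
the product is that of the graded tensor product. -/
abbrev WithTrace : Type _ :=
  GradedTensorProduct ℂ 𝒜 (SuperSym.grading (SuperCyclic 𝒜 0) (SuperCyclic 𝒜 1))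

/-- The inclusion of the trace algebra. -/
def WithTrace.ofTraceAlg : TraceAlg 𝒜 →ₐ[ℂ] WithTrace 𝒜 :=
  GradedTensorProduct.includeRight 𝒜 (SuperSym.grading (SuperCyclic 𝒜 0) (SuperCyclic 𝒜 1))

/-- The inclusion of the superalgebra `A` itself. -/
def WithTrace.of : A →ₐ[ℂ] WithTrace 𝒜 :=
  GradedTensorProduct.includeLeft 𝒜 (SuperSym.grading (SuperCyclic 𝒜 0) (SuperCyclic 𝒜 1))

/-- The trace operation of `A_t`, with values in the trace algebra: `t(a ⊗ c) = t(a) c`. -/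
def WithTrace.trace : WithTrace 𝒜 →ₗ[ℂ] TraceAlg 𝒜 :=
  LinearMap.mul' ℂ (TraceAlg 𝒜) ∘ₗ (formalTrace 𝒜).rTensor (TraceAlg 𝒜) ∘ₗ
    (GradedTensorProduct.of ℂ 𝒜
      (SuperSym.grading (SuperCyclic 𝒜 0) (SuperCyclic 𝒜 1))).symm.toLinearMap

end FreeTrace

/-! ### Evaluation in matrices over a supercommutative superalgebra -/

section Evaluation

variable {n : ℕ} {C : Type*} [Ring C] [Algebra ℂ C] {𝒞 : ZMod 2 → Submodule ℂ C} [GradedAlgebra 𝒞]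

theorem IsSuperComm.trace_mul {n : ℕ} {C : Type*} [Ring C] [Algebra ℂ C]
    {𝒞 : ZMod 2 → Submodule ℂ C} (hC : IsSuperComm 𝒞) {i j : ZMod 2}
    {P Q : Matrix (Fin n) (Fin n) C} (hP : ∀ h k, P h k ∈ 𝒞 i) (hQ : ∀ h k, Q h k ∈ 𝒞 j) :
    (P * Q).trace = (-1 : ℤˣ) ^ (i * j) • (Q * P).trace := by
  simp only [Matrix.trace, Matrix.diag, Matrix.mul_apply, Finset.smul_sum]
  rw [Finset.sum_comm]
  exact Finset.sum_congr rfl fun k _ => Finset.sum_congr rfl fun h _ => hC (hP h k) (hQ k h)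

variable {A : Type*} [Ring A] [Algebra ℂ A] {𝒜 : ZMod 2 → Submodule ℂ A}
  (hC : IsSuperComm 𝒞) (F : A →ₐ[ℂ] Matrix (Fin n) (Fin n) C)
  (hF : ∀ ⦃i : ZMod 2⦄ ⦃a : A⦄, a ∈ 𝒜 i → ∀ h k, F a h k ∈ 𝒞 i)

/-- The linear map `(A / [A, A]ₛ)ᵢ → Cᵢ`, `[a] ↦ tr(F(a))`, induced by a graded homomorphism
`F : A → Mₙ(C)`. -/
def cyclicTrace (i : ZMod 2) : SuperCyclic 𝒜 i →ₗ[ℂ] 𝒞 i :=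
  Submodule.liftQ _
    (LinearMap.codRestrict (𝒞 i)
      (Matrix.traceLinearMap (Fin n) ℂ C ∘ₗ F.toLinearMap ∘ₗ (𝒜 i).subtype)
      fun a => by
        change (∑ h, F a h h) ∈ 𝒞 i
        exact Submodule.sum_mem _ fun h _ => hF a.2 h h)
    (by
      rintro ⟨a, ha⟩ h
      have key : superCommutators 𝒜 ≤
          LinearMap.ker (Matrix.traceLinearMap (Fin n) ℂ C ∘ₗ F.toLinearMap) := by
        refine Submodule.span_le.2 ?_
        rintro _ ⟨i, j, a, ha, b, hb, rfl⟩
        have e := hC.trace_mul (hF ha) (hF hb)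
        have e2 : ((-1 : ℤˣ) ^ (i * j) • (F b * F a)).trace =
            (-1 : ℤˣ) ^ (i * j) • (F b * F a).trace := Matrix.trace_smul _ _
        have e3 : F ((-1 : ℤˣ) ^ (i * j) • (b * a)) = (-1 : ℤˣ) ^ (i * j) • (F b * F a) := by
          rw [Units.smul_def, Units.smul_def, map_zsmul, map_mul]
        change (F (a * b - (-1 : ℤˣ) ^ (i * j) • (b * a))).trace = 0
        rw [map_sub, e3, map_mul, Matrix.trace_sub, e2, e, sub_self]
      exact Subtype.ext (key h))

/-- The homomorphism of trace algebras `𝕂(A / [A, A]ₛ) → C` with `t(a) ↦ tr(F(a))`. -/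
def evalTraceAlg : TraceAlg 𝒜 →ₐ[ℂ] C :=
  SuperSym.lift hC (cyclicTrace hC F hF 0) (cyclicTrace hC F hF 1)

theorem evalTraceAlg_anticomm ⦃i j : ZMod 2⦄ (a : 𝒜 i)
    (b : SuperSym.grading (SuperCyclic 𝒜 0) (SuperCyclic 𝒜 1) j) :
    F a * ((Matrix.scalarAlgHom (Fin n) ℂ).comp (evalTraceAlg hC F hF)) b =
      (-1 : ℤˣ) ^ (j * i) •
        (((Matrix.scalarAlgHom (Fin n) ℂ).comp (evalTraceAlg hC F hF)) b * F a) := by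
  ext h k
  have hb : evalTraceAlg hC F hF b ∈ 𝒞 j := SuperSym.lift_mem hC _ _ b.2
  simpa [mul_comm j i] using hC (hF a.2 h k) hb

variable [GradedAlgebra 𝒜]

/-- The trace preserving homomorphism `A_t → Mₙ(C)` extending a graded homomorphism
`F : A → Mₙ(C)`; the trace algebra is mapped to `C`, embedded as scalar matrices. -/
def evalWithTrace : WithTrace 𝒜 →ₐ[ℂ] Matrix (Fin n) (Fin n) C :=
  GradedTensorProduct.lift 𝒜 (SuperSym.grading (SuperCyclic 𝒜 0) (SuperCyclic 𝒜 1)) F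
    ((Matrix.scalarAlgHom (Fin n) ℂ).comp (evalTraceAlg hC F hF)) (evalTraceAlg_anticomm hC F hF)

theorem evalWithTrace_of (a : A) : evalWithTrace hC F hF (WithTrace.of 𝒜 a) = F a :=
  (GradedTensorProduct.lift_tmul 𝒜 _ F _ (evalTraceAlg_anticomm hC F hF) a 1).trans (by simp)

theorem evalWithTrace_ofTraceAlg (c : TraceAlg 𝒜) :
    evalWithTrace hC F hF (WithTrace.ofTraceAlg 𝒜 c) =
      Matrix.scalar (Fin n) (evalTraceAlg hC F hF c) :=
  (GradedTensorProduct.lift_tmul 𝒜 _ F _ (evalTraceAlg_anticomm hC F hF) 1 c).trans (by simp)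

theorem evalTraceAlg_formalTrace (a : A) :
    evalTraceAlg hC F hF (formalTrace 𝒜 a) = (F a).trace := by
  induction a using DirectSum.Decomposition.inductionOn 𝒜 with
  | zero => simp
  | @homogeneous i a =>
    have h0 := SuperSym.lift_ιEven hC (cyclicTrace hC F hF 0) (cyclicTrace hC F hF 1)
    have h1 := SuperSym.lift_ιOdd hC (cyclicTrace hC F hF 0) (cyclicTrace hC F hF 1)
    simp only [formalTrace, LinearMap.add_apply, LinearMap.comp_apply, map_add, evalTraceAlg, h0, h1]
    fin_cases i
    · have e0 : (DirectSum.component ℂ (ZMod 2) (fun i => 𝒜 i) 0)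
          (DirectSum.decomposeLinearEquiv 𝒜 (a : A)) = a := by
        change DirectSum.decompose 𝒜 (a : A) 0 = a
        exact Subtype.ext (DirectSum.decompose_of_mem_same 𝒜 a.2)
      have e1 : (DirectSum.component ℂ (ZMod 2) (fun i => 𝒜 i) 1)
          (DirectSum.decomposeLinearEquiv 𝒜 (a : A)) = 0 := by
        change DirectSum.decompose 𝒜 (a : A) 1 = 0
        exact Subtype.ext (DirectSum.decompose_of_mem_ne 𝒜 a.2 zero_ne_one)
      erw [e0, e1]
      simp
      rfl
    · have e0 : (DirectSum.component ℂ (ZMod 2) (fun i => 𝒜 i) 1)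
          (DirectSum.decomposeLinearEquiv 𝒜 (a : A)) = a := by
        change DirectSum.decompose 𝒜 (a : A) 1 = a
        exact Subtype.ext (DirectSum.decompose_of_mem_same 𝒜 a.2)
      have e1 : (DirectSum.component ℂ (ZMod 2) (fun i => 𝒜 i) 0)
          (DirectSum.decomposeLinearEquiv 𝒜 (a : A)) = 0 := by
        change DirectSum.decompose 𝒜 (a : A) 0 = 0
        exact Subtype.ext (DirectSum.decompose_of_mem_ne 𝒜 a.2 one_ne_zero)
      erw [e0, e1]
      simp
      rfl
  | add a b ha hb => simp only [map_add, Matrix.trace_add, ha, hb]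

theorem evalTraceAlg_trace (x : WithTrace 𝒜) :
    evalTraceAlg hC F hF (WithTrace.trace 𝒜 x) = (evalWithTrace hC F hF x).trace := by
  change TensorProduct ℂ A (TraceAlg 𝒜) at x
  induction x using TensorProduct.induction_on with
  | zero => erw [map_zero, map_zero]; exact (Matrix.trace_zero (Fin n) C).symm
  | add x y hx hy =>
    refine ((congrArg _ (map_add _ _ _)).trans (map_add _ _ _)).trans ?_
    rw [hx, hy, ← Matrix.trace_add]
    exact congrArg _ (map_add _ _ _).symm
  | tmul a c =>
    change evalTraceAlg hC F hF (formalTrace 𝒜 a * c) =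
      (F a * Matrix.scalar (Fin n) (evalTraceAlg hC F hF c)).trace
    rw [map_mul, evalTraceAlg_formalTrace]
    simp [Matrix.trace, Finset.sum_mul]

end Evaluation

/-! ### The free superalgebra with trace -/

section Free

variable (e f : ℕ)

/-- The free algebra `ℂ⟨X, Y⟩`, with basis the words in the bosonic variables `y₁, …, yₑ`
(`Sum.inl i`) and the fermionic variables `x₁, …, x_f` (`Sum.inr j`). -/
abbrev FreeSuperAlg : Type := AddMonoidAlgebra ℂ (FreeAddMonoid (Fin e ⊕ Fin f))

/-- The parity of a word: the number of its fermionic letters modulo 2. -/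
def wordParity : FreeAddMonoid (Fin e ⊕ Fin f) →+ ZMod 2 :=
  FreeAddMonoid.lift (Sum.elim (fun _ => 0) fun _ => 1)

/-- The parity grading of the free algebra. -/
abbrev freeGrading : ZMod 2 → Submodule ℂ (FreeSuperAlg e f) :=
  AddMonoidAlgebra.gradeBy ℂ (wordParity e f)

/-- The trace algebra `𝒯` of the free superalgebra with trace. -/
abbrev FreeTraceAlg : Type := TraceAlg (freeGrading e f)

/-- The free superalgebra with trace `ℱ_T⟨X, Y⟩ = ℂ⟨X, Y⟩ ⊗̂ 𝒯`. -/
abbrev FreeSuperTrace : Type := WithTrace (freeGrading e f)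

end Free

/-! ### Generic bosonic and fermionic matrices -/

section Generic

variable (n e f : ℕ)

/-- The space of `m`-tuples of complex `n × n` matrices. -/
abbrev MatTuple (m : ℕ) : Type := Fin m → Matrix (Fin n) (Fin n) ℂ

/-- The algebra `S = 𝕂(V*) = S(V₀*) ⊗ ⋀ V₁*`, where `V₀` is the space of `e`-tuples and `V₁` the
space of `f`-tuples of matrices. -/
abbrev InvAmbient : Type :=
  SuperSym (Module.Dual ℂ (MatTuple n e)) (Module.Dual ℂ (MatTuple n f))

/-- The parity grading of `S`. -/
abbrev ambientGrading : ZMod 2 → Submodule ℂ (InvAmbient n e f) :=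
  SuperSym.grading (Module.Dual ℂ (MatTuple n e)) (Module.Dual ℂ (MatTuple n f))

variable {n}

/-- The coordinate function `(A₁, …, A_m) ↦ (Aᵢ)ₕₖ`. -/
def coordFun {m : ℕ} (i : Fin m) (h k : Fin n) : Module.Dual ℂ (MatTuple n m) :=
  Matrix.entryLinearMap ℂ ℂ h k ∘ₗ LinearMap.proj i

variable (n)

/-- The generic matrices: `ηᵢ`, with the even entries `ηₕₖ⁽ⁱ⁾`, and `ξⱼ`, with the odd entries
`ξₕₖ⁽ʲ⁾`. -/
def genericMatrix : Fin e ⊕ Fin f → Matrix (Fin n) (Fin n) (InvAmbient n e f)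
  | Sum.inl i => Matrix.of fun h k => SuperSym.ιEven _ _ (coordFun i h k)
  | Sum.inr j => Matrix.of fun h k => SuperSym.ιOdd _ _ (coordFun j h k)

/-- The monomial in the generic matrices given by a word. -/
def genericMonomial (w : List (Fin e ⊕ Fin f)) : Matrix (Fin n) (Fin n) (InvAmbient n e f) :=
  (w.map (genericMatrix n e f)).prod

/-- The evaluation `ℂ⟨X, Y⟩ → Mₙ(S)`, `yᵢ ↦ ηᵢ`, `xⱼ ↦ ξⱼ`. -/
def evalFree : FreeSuperAlg e f →ₐ[ℂ] Matrix (Fin n) (Fin n) (InvAmbient n e f) :=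
  AddMonoidAlgebra.lift ℂ _ _
    { toFun := fun w => genericMonomial n e f w.toAdd.toList
      map_one' := by simp [genericMonomial]
      map_mul' := fun v w => by simp [genericMonomial] }

theorem genericMonomial_mem (w : List (Fin e ⊕ Fin f)) (h k : Fin n) :
    genericMonomial n e f w h k ∈
      ambientGrading n e f (wordParity e f (FreeAddMonoid.ofList w)) := by
  induction w generalizing h k with
  | nil =>
    by_cases hk : h = k
    · subst hk
      simpa [genericMonomial] using SetLike.GradedOne.one_mem (A := ambientGrading n e f)
    · simp [genericMonomial, Matrix.one_apply_ne hk]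
  | cons x w ih =>
    have hx : ∀ l, genericMatrix n e f x h l ∈
        ambientGrading n e f (wordParity e f (FreeAddMonoid.of x)) := by
      intro l
      cases x with
      | inl i => simpa [wordParity, genericMatrix] using SuperSym.ιEven_mem (coordFun i h l)
      | inr j => simpa [wordParity, genericMatrix] using SuperSym.ιOdd_mem (coordFun j h l)
    have hw : genericMonomial n e f (x :: w) = genericMatrix n e f x * genericMonomial n e f w := by
      simp [genericMonomial]
    rw [hw, Matrix.mul_apply, FreeAddMonoid.ofList_cons, map_add]
    exact Submodule.sum_mem _ fun l _ => SetLike.mul_mem_graded (hx l) (ih l k)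

theorem evalFree_mem ⦃i : ZMod 2⦄ ⦃a : FreeSuperAlg e f⦄ (ha : a ∈ freeGrading e f i)
    (h k : Fin n) : evalFree n e f a h k ∈ ambientGrading n e f i := by
  rw [evalFree, AddMonoidAlgebra.lift_apply, Finsupp.sum, Matrix.sum_apply]
  refine Submodule.sum_mem _ fun w hw => ?_
  rw [Matrix.smul_apply]
  have := genericMonomial_mem n e f w.toList h k
  rw [FreeAddMonoid.ofList_toList, ha w hw] at this
  exact Submodule.smul_mem _ _ this

/-- The evaluation of the free superalgebra with trace in `Mₙ(S)`: the trace preserving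
homomorphism with `yᵢ ↦ ηᵢ` and `xⱼ ↦ ξⱼ`. -/
def evalGeneric : FreeSuperTrace e f →ₐ[ℂ] Matrix (Fin n) (Fin n) (InvAmbient n e f) :=
  evalWithTrace (SuperSym.isSuperComm _ _) (evalFree n e f) (evalFree_mem n e f)

/-- The restriction `𝒯 → S` of the evaluation to the trace algebras. -/
def evalGenericTrace : FreeTraceAlg e f →ₐ[ℂ] InvAmbient n e f :=
  evalTraceAlg (SuperSym.isSuperComm _ _) (evalFree n e f) (evalFree_mem n e f)

end Generic

/-! ### The action of the general linear group -/

section Action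

variable {n : ℕ} (e f : ℕ)

/-- Simultaneous conjugation `(A₁, …, A_m) ↦ (g A₁ g⁻¹, …, g A_m g⁻¹)`. -/
def conjTuple (m : ℕ) (g : GL (Fin n) ℂ) : MatTuple n m →ₗ[ℂ] MatTuple n m where
  toFun A := fun i => (g : Matrix (Fin n) (Fin n) ℂ) * A i * (g⁻¹ : GL (Fin n) ℂ)
  map_add' A B := by funext i; simp [mul_add, add_mul]
  map_smul' c A := by funext i; simp

/-- The contragredient action on linear functions, `(g φ)(A) = φ(g⁻¹ A)`. -/
def dualAct (m : ℕ) (g : GL (Fin n) ℂ) :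
    Module.Dual ℂ (MatTuple n m) →ₗ[ℂ] Module.Dual ℂ (MatTuple n m) :=
  Module.Dual.transpose (R := ℂ) (conjTuple m g⁻¹)

/-- The action of `g` on `S = S(V₀*) ⊗ ⋀ V₁*` by algebra automorphisms extending the action
on `V*`. -/
def actS (g : GL (Fin n) ℂ) : InvAmbient n e f →ₐ[ℂ] InvAmbient n e f :=
  Algebra.TensorProduct.map
    (SymmetricAlgebra.lift (SymmetricAlgebra.ι ℂ (Module.Dual ℂ (MatTuple n e)) ∘ₗ dualAct e g))
    (ExteriorAlgebra.map (dualAct f g))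

/-- A complex matrix as a matrix over `S`. -/
abbrev constMat : Matrix (Fin n) (Fin n) ℂ →ₐ[ℂ] Matrix (Fin n) (Fin n) (InvAmbient n e f) :=
  (Algebra.ofId ℂ (InvAmbient n e f)).mapMatrix

theorem constMat_inv_mul (g : GL (Fin n) ℂ) :
    constMat e f ((g⁻¹ : GL (Fin n) ℂ) : Matrix (Fin n) (Fin n) ℂ) * constMat e f g = 1 := by
  rw [← map_mul, ← Units.val_mul, inv_mul_cancel, Units.val_one, map_one]

theorem constMat_mul_inv (g : GL (Fin n) ℂ) :
    constMat e f g * constMat e f ((g⁻¹ : GL (Fin n) ℂ) : Matrix (Fin n) (Fin n) ℂ) = 1 := by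
  rw [← map_mul, ← Units.val_mul, mul_inv_cancel, Units.val_one, map_one]

/-- The diagonal action of `g` on `Mₙ(S) = Mₙ(ℂ) ⊗ S`: conjugation by `g` on `Mₙ(ℂ)` and
the action `actS` on the entries. -/
def actMat (g : GL (Fin n) ℂ) :
    Matrix (Fin n) (Fin n) (InvAmbient n e f) →ₐ[ℂ] Matrix (Fin n) (Fin n) (InvAmbient n e f) where
  toFun M := constMat e f g * (actS e f g).mapMatrix M *
    constMat e f ((g⁻¹ : GL (Fin n) ℂ) : Matrix (Fin n) (Fin n) ℂ)
  map_one' := by rw [map_one, mul_one, constMat_mul_inv]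
  map_mul' M N := by
    have hg := constMat_inv_mul e f g
    rw [map_mul]
    simp only [mul_assoc]
    rw [← mul_assoc (constMat e f _) (constMat e f _), hg, one_mul]
  map_zero' := by rw [map_zero, mul_zero, zero_mul]
  map_add' M N := by rw [map_add, mul_add, add_mul]
  commutes' r := by
    rw [AlgHom.commutes, ← Algebra.commutes, mul_assoc, constMat_mul_inv, mul_one]

variable (n)

/-- The algebra `𝒯ₙ = S^G` of invariants, `G = GL(n, ℂ)`. -/
def invariants : Subalgebra ℂ (InvAmbient n e f) where
  carrier := {s | ∀ g : GL (Fin n) ℂ, actS e f g s = s}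
  mul_mem' ha hb g := by rw [map_mul, ha g, hb g]
  add_mem' ha hb g := by rw [map_add, ha g, hb g]
  algebraMap_mem' r g := AlgHom.commutes _ r

/-- The algebra `ℰₙ = Mₙ(S)^G` of equivariant maps, `G = GL(n, ℂ)`. -/
def equivariants : Subalgebra ℂ (Matrix (Fin n) (Fin n) (InvAmbient n e f)) where
  carrier := {M | ∀ g : GL (Fin n) ℂ, actMat e f g M = M}
  mul_mem' ha hb g := by rw [map_mul, ha g, hb g]
  add_mem' ha hb g := by rw [map_add, ha g, hb g]
  algebraMap_mem' r g := AlgHom.commutes _ r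

end Action

end

/-!
Every entry of a matrix over `S` is a combination of products of entries of the generic matrices
and the identity matrix, all with the same number `d` of factors. A matrix over `S` is therefore the
image of a family of coefficient matrices in `End ((ℂⁿ)^{⊗ (d + 1)})`, indexed by the words of
length `d`, the last tensor factor carrying the position of the entry; the group acts on
coefficients by conjugation with `g ⊗ ⋯ ⊗ g`. The coefficients of an equivariant matrix are only
determined modulo the kernel of this map, but replacing them by their component orthogonal to that
kernel makes them commute with every `g ⊗ ⋯ ⊗ g`, as the group is closed under adjoints. By
Schur–Weyl duality they are then combinations of permutations of the tensor factors, and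
contracting a word of generic matrices along a permutation gives, up to the sign of reordering
entries in the supercommutative algebra `S`, a product of traces of monomials times a monomial.
Invariants are recovered from the traces of scalar matrices, on dividing by `n`.
-/

noncomputable section

section TensorPower

variable {R ι κ : Type*} [CommSemiring R] [Fintype ι] [DecidableEq ι] [Fintype κ] [DecidableEq κ]

variable (ι) in
/-- The tensor power `A ↦ A ⊗ ⋯ ⊗ A` of square matrices, with one factor for each element of `ι`.
The basis tensors are encoded as functions `ι → κ`. -/
def tensorPow : Matrix κ κ R →* Matrix (ι → κ) (ι → κ) R where
  toFun A := Matrix.of fun i j => ∏ a, A (i a) (j a)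
  map_one' := by
    ext i j
    simp [Matrix.one_apply, Finset.prod_ite_zero, funext_iff]
  map_mul' A B := by
    ext i j
    simp only [Matrix.of_apply, Matrix.mul_apply, Finset.prod_univ_sum, Fintype.piFinset_univ,
      Finset.prod_mul_distrib]

theorem tensorPow_apply (A : Matrix κ κ R) (i j : ι → κ) :
    tensorPow ι A i j = ∏ a, A (i a) (j a) := rfl

theorem tensorPow_conjTranspose [StarRing R] (A : Matrix κ κ R) :
    tensorPow ι A.conjTranspose = (tensorPow ι A).conjTranspose := by
  ext i j
  simp only [tensorPow_apply, Matrix.conjTranspose_apply, star_prod]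

/-- The permutation matrices of the tensor factors, acting on coordinate functions `v` of tensors by
`(σ v) i = v (i ∘ σ)`. -/
def placePerm (R ι κ : Type*) [CommSemiring R] [Fintype ι] [DecidableEq ι] [Fintype κ]
    [DecidableEq κ] : Equiv.Perm ι →* Matrix (ι → κ) (ι → κ) R where
  toFun σ := Matrix.of fun i j => if i ∘ σ = j then 1 else 0
  map_one' := by
    ext i j
    simp [Matrix.one_apply]
  map_mul' σ τ := by
    ext i j
    simp only [Matrix.mul_apply, Matrix.of_apply, ite_mul, one_mul, zero_mul, Finset.sum_ite_eq,
      Finset.mem_univ, if_true]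
    rfl

theorem placePerm_apply (σ : Equiv.Perm ι) (i j : ι → κ) :
    placePerm R ι κ σ i j = if i ∘ σ = j then 1 else 0 := rfl

theorem placePerm_mul_apply (σ : Equiv.Perm ι) (B : Matrix (ι → κ) (ι → κ) R) (i j : ι → κ) :
    (placePerm R ι κ σ * B) i j = B (i ∘ σ) j := by
  simp [Matrix.mul_apply, placePerm_apply]

theorem mul_placePerm_apply (σ : Equiv.Perm ι) (B : Matrix (ι → κ) (ι → κ) R) (i j : ι → κ) :
    (B * placePerm R ι κ σ) i (j ∘ σ) = B i j := by
  simp [Matrix.mul_apply, placePerm_apply, σ.surjective.injective_comp_right.eq_iff]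

end TensorPower

section SymmetricTensor

variable {ι α : Type*} [Fintype ι]

theorem exists_perm_comp_eq {f g : ι → α}
    (h : ∑ a, Finsupp.single (f a) 1 = ∑ a, Finsupp.single (g a) 1) :
    ∃ σ : Equiv.Perm ι, g ∘ σ = f := by
  classical
  have card_fiber (x : α) : Fintype.card {a // f a = x} = Fintype.card {a // g a = x} := by
    simpa [Finsupp.single_apply, Fintype.card_subtype] using DFunLike.congr_fun h x
  let e (x : α) : {a // f a = x} ≃ {a // g a = x} := Fintype.equivOfCardEq (card_fiber x)
  exact ⟨(Equiv.sigmaFiberEquiv f).symm.trans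
    ((Equiv.sigmaCongrRight e).trans (Equiv.sigmaFiberEquiv g)),
    funext fun a => (e (f a) ⟨a, rfl⟩).2⟩

theorem sum_mul_eq_zero_of_sum_smul_prod_X_eq_zero {R : Type*} [CommSemiring R] [Fintype α]
    [DecidableEq ι] {l B : (ι → α) → R}
    (hl : ∑ J, l J • ∏ a, MvPolynomial.X (J a) = (0 : MvPolynomial α R))
    (hB : ∀ (σ : Equiv.Perm ι) J, B (J ∘ σ) = B J) : ∑ J, l J * B J = 0 := by
  let exponent (J : ι → α) : α →₀ ℕ := ∑ a, Finsupp.single (J a) 1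
  have B_factors : B.FactorsThrough exponent := fun J J' h => by
    obtain ⟨σ, rfl⟩ := exists_perm_comp_eq h
    exact hB σ J'
  let Λ := (MvPolynomial.basisMonomials α R).constr R (Function.extend exponent B 0)
  have Λ_prod (J : ι → α) : Λ (∏ a, MvPolynomial.X (J a)) = B J := by
    have prod_X_eq : ∏ a, MvPolynomial.X (J a) =
        MvPolynomial.basisMonomials α R (exponent J) := by
      simp [MvPolynomial.X, exponent, MvPolynomial.monomial_sum_one]
    rw [prod_X_eq, Module.Basis.constr_basis, B_factors.extend_apply]
  simpa only [map_sum, map_smul, map_zero, Λ_prod, smul_eq_mul] using congrArg Λ hl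

end SymmetricTensor

section SchurWeyl

theorem mem_span_range_of_forall_commute {k G V : Type*} [Field k] [Group G] [Finite G]
    [NeZero (Nat.card G : k)] [AddCommGroup V] [Module k V] [Module.Finite k V]
    (ρ : Representation k G V) {T : Module.End k V}
    (hT : ∀ B : Module.End k V, (∀ g, Commute B (ρ g)) → Commute T B) :
    T ∈ Submodule.span k (Set.range ρ) := by
  let f : Module.End (Module.End (MonoidAlgebra k G) ρ.asModule) ρ.asModule :=
    { toFun := T
      map_add' := T.map_add
      map_smul' φ v := by
        have φ_comm (g : G) : Commute (φ.restrictScalars k : Module.End k V) (ρ g) :=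
          LinearMap.ext fun w => by
            simpa [Representation.single_smul] using! φ.map_smul (MonoidAlgebra.single g (1 : k)) w
        exact LinearMap.congr_fun (hT _ φ_comm) v }
  obtain ⟨s, hs⟩ := Module.Finite.fg_top (R := k) (M := V)
  obtain ⟨r, hr⟩ := jacobson_density f s
  have T_eq : T = ρ.asAlgebraHom r :=
    LinearMap.ext_on hs fun v hv => (hr v hv).trans (ρ.asModuleEquiv_map_smul r v)
  rw [T_eq, Representation.asAlgebraHom_def, MonoidAlgebra.lift_apply]
  exact Submodule.sum_mem _ fun g _ => Submodule.smul_mem _ _ (Submodule.subset_span ⟨g, rfl⟩)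

variable {K ι κ : Type*} [Field K] [Fintype ι] [DecidableEq ι] [Fintype κ] [DecidableEq κ]

theorem sum_mul_eq_zero_of_forall_GL [Infinite K] {l B : (ι → κ × κ) → K}
    (hl : ∀ g : GL κ K, ∑ J, l J * ∏ a, (g : Matrix κ κ K) (J a).1 (J a).2 = 0)
    (hB : ∀ (σ : Equiv.Perm ι) J, B (J ∘ σ) = B J) : ∑ J, l J * B J = 0 := by
  refine sum_mul_eq_zero_of_sum_smul_prod_X_eq_zero
    (MvPolynomial.eq_of_eval_eq_on_gl fun g => ?_) hB
  simpa [map_sum, map_prod, MvPolynomial.smul_eval] using hl g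

theorem commute_of_forall_commute_tensorPow [Infinite K] {T B : Matrix (ι → κ) (ι → κ) K}
    (hT : ∀ g : GL κ K, Commute T (tensorPow ι (g : Matrix κ κ K)))
    (hB : ∀ (σ : Equiv.Perm ι) i j, B (i ∘ σ) (j ∘ σ) = B i j) : Commute T B := by
  ext i k
  let pair : (ι → κ × κ) ≃ (ι → κ) × (ι → κ) := Equiv.arrowProdEquivProdArrow _ _ _
  let l (q : (ι → κ) × (ι → κ)) : K :=
    (if q.2 = k then T i q.1 else 0) - (if q.1 = i then T q.2 k else 0)
  have commutator_apply (A : Matrix (ι → κ) (ι → κ) K) :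
      (T * A) i k - (A * T) i k = ∑ J, l (pair J) * A (pair J).1 (pair J).2 := by
    rw [pair.sum_comp (fun q => l q * A q.1 q.2), Fintype.sum_prod_type]
    simp only [l, sub_mul, Finset.sum_sub_distrib, Matrix.mul_apply, ite_mul, zero_mul]
    congr 1
    · simp
    · rw [Finset.sum_comm]
      simp [mul_comm]
  rw [← sub_eq_zero, commutator_apply]
  refine sum_mul_eq_zero_of_forall_GL (l := l ∘ pair) (fun g => ?_)
    fun σ J => hB σ (pair J).1 (pair J).2
  refine (commutator_apply (tensorPow ι (g : Matrix κ κ K))).symm.trans ?_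
  rw [(hT g).eq, sub_self]

theorem mem_span_range_placePerm [Infinite K] [NeZero (Nat.card (Equiv.Perm ι) : K)]
    {T : Matrix (ι → κ) (ι → κ) K}
    (hT : ∀ g : GL κ K, Commute T (tensorPow ι (g : Matrix κ κ K))) :
    T ∈ Submodule.span K (Set.range (placePerm K ι κ)) := by
  let L : Matrix (ι → κ) (ι → κ) K ≃ₐ[K] Module.End K ((ι → κ) → K) := Matrix.toLinAlgEquiv'
  let ρ : Representation K (Equiv.Perm ι) ((ι → κ) → K) :=
    (L : Matrix (ι → κ) (ι → κ) K →* _).comp (placePerm K ι κ)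
  have LT_mem : L T ∈ Submodule.span K (Set.range ρ) := by
    refine mem_span_range_of_forall_commute ρ fun B' hB => ?_
    obtain ⟨B, rfl⟩ := L.surjective B'
    refine (commute_of_forall_commute_tensorPow hT fun σ i j => ?_).map L
    have B_comm : B * placePerm K ι κ σ = placePerm K ι κ σ * B :=
      L.injective (by simpa only [map_mul] using! (hB σ).eq)
    rw [← placePerm_mul_apply σ B, ← B_comm, mul_placePerm_apply]
  have range_ρ : Set.range ρ = L.toLinearMap '' Set.range (placePerm K ι κ) :=
    Set.range_comp L (placePerm K ι κ)
  rw [range_ρ, Submodule.span_image] at LT_mem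
  obtain ⟨T', hT', L_eq⟩ := LT_mem
  exact L.injective L_eq ▸ hT'

end SchurWeyl

section FixedLift

open scoped ComplexOrder Matrix

variable {𝕜 : Type*} [RCLike 𝕜]

theorem exists_sub_mem_forall_apply_eq_self {E G : Type*} [NormedAddCommGroup E]
    [InnerProductSpace 𝕜 E] {ρ : G → E →ₗ[𝕜] E} {W : Submodule 𝕜 E} [W.HasOrthogonalProjection]
    (ρ_adjoint : ∀ g, ∃ g', ∀ x y, inner 𝕜 x (ρ g y) = inner 𝕜 (ρ g' x) y)
    (ρ_mem : ∀ g, ∀ x ∈ W, ρ g x ∈ W) {x : E} (hx : ∀ g, ρ g x - x ∈ W) :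
    ∃ y, x - y ∈ W ∧ ∀ g, ρ g y = y := by
  obtain ⟨w, hw, y, hy, rfl⟩ := W.exists_add_mem_mem_orthogonal x
  refine ⟨y, by simpa using hw, fun g => ?_⟩
  have ρy_mem_orthogonal : ρ g y ∈ Wᗮ := by
    obtain ⟨g', hg'⟩ := ρ_adjoint g
    refine (W.mem_orthogonal _).2 fun u hu => ?_
    rw [hg', (W.mem_orthogonal _).1 hy _ (ρ_mem g' u hu)]
  have ρy_sub_mem : ρ g y - y ∈ W := by
    have sub_sub_mem := sub_mem (hx g) (sub_mem (ρ_mem g w hw) hw)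
    rwa [map_add, add_sub_add_comm, add_sub_cancel_left] at sub_sub_mem
  exact sub_eq_zero.1
    (Submodule.disjoint_def.1 W.orthogonal_disjoint _ ρy_sub_mem (sub_mem ρy_mem_orthogonal hy))

theorem trace_conj_mul_conjTranspose {I : Type*} [Fintype I] [DecidableEq I]
    (u : (Matrix I I 𝕜)ˣ) (X Y : Matrix I I 𝕜) :
    (u * Y * u⁻¹.val * Xᴴ).trace = (Y * ((star u).val * X * (star u)⁻¹.val)ᴴ).trace := by
  rw [Units.coe_star_inv, Units.coe_star, Matrix.star_eq_conjTranspose,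
    Matrix.star_eq_conjTranspose, Matrix.conjTranspose_mul, Matrix.conjTranspose_mul,
    Matrix.conjTranspose_conjTranspose, Matrix.conjTranspose_conjTranspose, mul_assoc, mul_assoc,
    Matrix.trace_mul_comm]
  simp only [mul_assoc]

theorem exists_sub_mem_forall_commute {ω I G : Type*} [Finite ω] [Fintype I] [DecidableEq I]
    {u : G → (Matrix I I 𝕜)ˣ} (u_star : ∀ g, ∃ g', u g' = star (u g))
    {W : Submodule 𝕜 (ω → Matrix I I 𝕜)}
    (hW : ∀ g, ∀ c ∈ W, (fun w => u g * c w * (u g)⁻¹.val) ∈ W) {c : ω → Matrix I I 𝕜}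
    (hc : ∀ g, (fun w => u g * c w * (u g)⁻¹.val) - c ∈ W) :
    ∃ c', c - c' ∈ W ∧ ∀ g w, Commute (c' w) (u g) := by
  cases nonempty_fintype ω
  let : NormedAddCommGroup (Matrix I I 𝕜) := Matrix.toMatrixNormedAddCommGroup 1 Matrix.PosDef.one
  let : InnerProductSpace 𝕜 (Matrix I I 𝕜) :=
    Matrix.toMatrixInnerProductSpace 1 Matrix.PosSemidef.one
  have inner_eq (X Y : Matrix I I 𝕜) : inner 𝕜 X Y = (Y * Xᴴ).trace :=
    congrArg (fun Z => (Z * Xᴴ).trace) (mul_one Y)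
  let conj (g : G) : PiLp 2 (fun _ : ω => Matrix I I 𝕜) →ₗ[𝕜] PiLp 2 (fun _ : ω => Matrix I I 𝕜) :=
    { toFun c := WithLp.toLp 2 fun w => u g * c w * (u g)⁻¹.val
      map_add' c c' := by
        ext1 w
        simp [mul_add, add_mul]
      map_smul' r c := by
        ext1 w
        simp }
  have conj_adjoint (g : G) : ∃ g', ∀ x y, inner 𝕜 x (conj g y) = inner 𝕜 (conj g' x) y := by
    obtain ⟨g', hg'⟩ := u_star g
    refine ⟨g', fun x y => ?_⟩
    simp only [PiLp.inner_apply, inner_eq]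
    refine Finset.sum_congr rfl fun w _ => ?_
    simpa only [← hg'] using! trace_conj_mul_conjTranspose (u g) (x w) (y w)
  obtain ⟨c', hc', conj_c'⟩ := exists_sub_mem_forall_apply_eq_self (ρ := conj)
    (W := W.comap (WithLp.linearEquiv 2 𝕜 (ω → Matrix I I 𝕜)).toLinearMap) (x := WithLp.toLp 2 c)
    conj_adjoint (fun g x hx => hW g _ hx) hc
  refine ⟨c'.ofLp, hc', fun g w => ?_⟩
  have conj_mul_eq := congrArg (· * (u g : Matrix I I 𝕜))
    (congrFun (congrArg WithLp.ofLp (conj_c' g)) w)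
  exact (by simpa [conj, mul_assoc] using conj_mul_eq.symm : _ = _)

theorem mem_span_range_single_placePerm {ω ι κ N : Type*} [Finite ω] [DecidableEq ω] [Fintype ι]
    [DecidableEq ι] [Fintype κ] [DecidableEq κ] [AddCommGroup N] [Module 𝕜 N]
    {Φ : (ω → Matrix (ι → κ) (ι → κ) 𝕜) →ₗ[𝕜] N} {Γ : GL κ 𝕜 → N → N}
    (hΦ : ∀ g c, Φ (fun w => tensorPow ι g.val * c w * tensorPow ι g⁻¹.val) = Γ g (Φ c)) {s : N}
    (hs : s ∈ LinearMap.range Φ) (hΓ : ∀ g, Γ g s = s) :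
    s ∈ Submodule.span 𝕜
      (Set.range fun q : ω × Equiv.Perm ι => Φ (Pi.single q.1 (placePerm 𝕜 ι κ q.2))) := by
  obtain ⟨c, rfl⟩ := hs
  obtain ⟨c', hcc', hc'⟩ := exists_sub_mem_forall_commute (W := LinearMap.ker Φ) (c := c)
    (u := Units.map (tensorPow ι : Matrix κ κ 𝕜 →* _))
    (fun g => ⟨star g, Units.ext (tensorPow_conjTranspose g.val)⟩)
    (fun g b hb => by
      have Γ_zero := hΦ g 0
      simp only [Pi.zero_apply, mul_zero, zero_mul, ← Pi.zero_def, map_zero] at Γ_zero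
      exact (hΦ g b).trans (by rw [LinearMap.mem_ker.1 hb, ← Γ_zero]))
    (fun g => by
      rw [LinearMap.mem_ker, map_sub, sub_eq_zero]
      exact (hΦ g c).trans (hΓ g))
  rw [LinearMap.mem_ker, map_sub, sub_eq_zero] at hcc'
  cases nonempty_fintype ω
  rw [hcc', ← Finset.univ_sum_single c', map_sum]
  refine Submodule.sum_mem _ fun w _ => ?_
  have single_mem := Submodule.mem_map_of_mem (f := Φ ∘ₗ LinearMap.single 𝕜 _ w)
    (mem_span_range_placePerm fun g => hc' g w)
  rw [← Submodule.span_image, ← Set.range_comp] at single_mem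
  exact Submodule.span_mono (Set.range_comp_subset_range (Prod.mk w) _) single_mem

end FixedLift

section SuperComm

variable {C : Type*} [Ring C] [Algebra ℂ C] {𝒞 : ZMod 2 → Submodule ℂ C}

theorem IsSuperComm.mul_prod_ofFn [GradedAlgebra 𝒞] (h𝒞 : IsSuperComm 𝒞) {d : ℕ} {i : ZMod 2}
    {p : Fin d → ZMod 2} {x : C} {y : Fin d → C} (hx : x ∈ 𝒞 i) (hy : ∀ j, y j ∈ 𝒞 (p j)) :
    x * (List.ofFn y).prod = (-1 : ℤˣ) ^ (i * (List.ofFn p).sum) • ((List.ofFn y).prod * x) :=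
  h𝒞 hx (SetLike.list_prod_ofFn_mem_graded p y hy)

theorem IsSuperComm.mul_prod_ofFn_update (h𝒞 : IsSuperComm 𝒞) {d : ℕ} {i : ZMod 2}
    {p : Fin d → ZMod 2} {x : C} {y : Fin d → C} (hx : x ∈ 𝒞 i) (hy : ∀ j, y j ∈ 𝒞 (p j))
    (j : Fin d) (z : C) : x * (List.ofFn (Function.update y j z)).prod =
      (-1 : ℤˣ) ^ (i * ((List.ofFn p).take j).sum) •
        (List.ofFn (Function.update y j (x * z))).prod := by
  induction d with
  | zero => exact j.elim0
  | succ d ih =>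
    cases j using Fin.cases with
    | zero => simp [List.ofFn_succ, mul_assoc]
    | succ j =>
      have tail_update (c : C) : (fun k : Fin d => Function.update y j.succ c k.succ) =
          Function.update (fun k => y k.succ) j c := Fin.tail_update_succ ..
      simp only [List.ofFn_succ, List.prod_cons, tail_update,
        Function.update_of_ne (Fin.succ_ne_zero j).symm, Fin.val_succ, List.take_succ_cons,
        List.sum_cons]
      rw [← mul_assoc, h𝒞 hx (hy 0), smul_mul_assoc, mul_assoc, ih (fun k => hy k.succ) j,
        mul_smul_comm, smul_smul, mul_add, uzpow_add]

end SuperComm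

section PermDecomposition

variable {α : Type*} {d : ℕ}

theorem cons_comp_decomposeFin_symm_zero (σ : Equiv.Perm (Fin (d + 1))) (a : α)
    (k : Fin (d + 1) → α) :
    (Fin.cons a k : Fin (d + 2) → α) ∘ Equiv.Perm.decomposeFin.symm (0, σ) =
      Fin.cons a (k ∘ σ) := by
  ext i
  cases i using Fin.cases <;> simp

theorem cons_comp_decomposeFin_symm_succ (σ : Equiv.Perm (Fin (d + 1))) (j : Fin (d + 1)) (a : α)
    (k : Fin (d + 1) → α) :
    (Fin.cons a k : Fin (d + 2) → α) ∘ Equiv.Perm.decomposeFin.symm ((σ j).succ, σ) =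
      Fin.cons (k (σ j)) (Function.update (k ∘ σ) j a) := by
  ext i
  cases i using Fin.cases with
  | zero => simp
  | succ i =>
    obtain rfl | hij := eq_or_ne i j
    · simp
    · have swap_apply : Equiv.swap 0 (σ j).succ (σ i).succ = (σ i).succ :=
        Equiv.swap_apply_of_ne_of_ne (Fin.succ_ne_zero _) (by simpa using hij)
      simp [hij, swap_apply]

end PermDecomposition

section OpenContraction

variable {C ν : Type*} [Semiring C] {d : ℕ}

/-- The product of the entries `M i (h i) (k i)`, placed at the entry `(k d, h d)` of a matrix. With
`d` factors and one place left open, it is a coordinate of the tensor `M 0 ⊗ ⋯ ⊗ M (d - 1)` in `d`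
matrix slots, paired with an elementary matrix in the last slot. -/
def slotMatrix [DecidableEq ν] (M : Fin d → Matrix ν ν C) (h k : Fin (d + 1) → ν) : Matrix ν ν C :=
  Matrix.single (k (Fin.last d)) (h (Fin.last d))
    (List.ofFn fun i => M i (h i.castSucc) (k i.castSucc)).prod

theorem slotMatrix_update_last [DecidableEq ν] (M : Fin d → Matrix ν ν C) (h k : Fin (d + 1) → ν)
    (a : ν) : slotMatrix M (Function.update h (Fin.last d) a) k = Matrix.single (k (Fin.last d)) a
      (List.ofFn fun i => M i (h i.castSucc) (k i.castSucc)).prod := by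
  simp [slotMatrix, (Fin.castSucc_lt_last _).ne]

theorem slotMatrix_update_castSucc [DecidableEq ν] (M : Fin d → Matrix ν ν C)
    (h k : Fin (d + 1) → ν) (i : Fin d) (a : ν) :
    slotMatrix M (Function.update h i.castSucc a) k =
      Matrix.single (k (Fin.last d)) (h (Fin.last d)) (List.ofFn (Function.update
        (fun j => M j (h j.castSucc) (k j.castSucc)) i (M i a (k i.castSucc)))).prod := by
  have entries_update : (fun j => M j (Function.update h i.castSucc a j.castSucc) (k j.castSucc)) =
      Function.update (fun j => M j (h j.castSucc) (k j.castSucc)) i (M i a (k i.castSucc)) := by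
    ext j
    obtain rfl | hj := eq_or_ne j i <;> simp [*]
  rw [slotMatrix, entries_update, Function.update_of_ne (Fin.castSucc_lt_last i).ne']

variable [Fintype ν] [DecidableEq ν]

theorem slotMatrix_update_mul (M : Fin d → Matrix ν ν C) (A B : Matrix ν ν C)
    (h k : Fin (d + 1) → ν) (i : Fin d) :
    slotMatrix (Function.update M i (A * B)) h k = ∑ a, Matrix.single (k (Fin.last d))
      (h (Fin.last d)) (List.ofFn (Function.update (fun j => M j (h j.castSucc) (k j.castSucc)) i
        (A (h i.castSucc) a * B a (k i.castSucc)))).prod := by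
  have entries_update : (fun j => Function.update M i (A * B) j (h j.castSucc) (k j.castSucc)) =
      Function.update (fun j => M j (h j.castSucc) (k j.castSucc)) i
        (∑ a, A (h i.castSucc) a * B a (k i.castSucc)) := by
    ext j
    obtain rfl | hj := eq_or_ne j i <;> simp [Matrix.mul_apply, *]
  have prod_update_sum := (MultilinearMap.mkPiAlgebraFin ℕ d C).map_update_sum Finset.univ i
    (fun a => A (h i.castSucc) a * B a (k i.castSucc)) fun j => M j (h j.castSucc) (k j.castSucc)
  simp only [MultilinearMap.mkPiAlgebraFin_apply] at prod_update_sum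
  rw [slotMatrix, entries_update, prod_update_sum]
  exact map_sum (Matrix.singleAddMonoidHom _ _) _ _

/-- The contraction of the upper indices of the slots with the lower ones along `σ`. Up to the signs
of reordering it is a product of traces, one for each cycle of `σ` avoiding the last slot, times the
product of the matrices along the cycle of the last slot. -/
def openContraction (M : Fin d → Matrix ν ν C) (σ : Equiv.Perm (Fin (d + 1))) : Matrix ν ν C :=
  ∑ k : Fin (d + 1) → ν, slotMatrix M (k ∘ σ) k

theorem openContraction_fin_zero (M : Fin 0 → Matrix ν ν C) (σ : Equiv.Perm (Fin 1)) :
    openContraction M σ = 1 := by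
  rw [openContraction, ← (Equiv.funUnique (Fin 1) ν).symm.sum_comp, Subsingleton.elim σ 1]
  simp [slotMatrix, Matrix.sum_single_one]

theorem openContraction_succ_eq_sum_cons (M : Fin (d + 1) → Matrix ν ν C)
    (σ : Equiv.Perm (Fin (d + 2))) :
    openContraction M σ = ∑ k : Fin (d + 1) → ν, ∑ a : ν,
      slotMatrix M ((Fin.cons a k : Fin (d + 2) → ν) ∘ σ) (Fin.cons a k) := by
  rw [openContraction, ← (Fin.consEquiv fun _ => ν).sum_comp, Fintype.sum_prod_type,
    Finset.sum_comm]
  rfl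

theorem slotMatrix_cons (M : Fin (d + 1) → Matrix ν ν C) (b a : ν) (h k : Fin (d + 1) → ν) :
    slotMatrix M (Fin.cons b h) (Fin.cons a k) =
      Matrix.scalar ν (M 0 b a) * slotMatrix (Fin.tail M) h k := by
  simp only [slotMatrix, List.ofFn_succ, List.prod_cons, Fin.castSucc_zero, Fin.castSucc_succ,
    ← Fin.succ_last, Fin.cons_zero, Fin.cons_succ]
  ext i j
  simp [Fin.tail, Matrix.single_apply]

theorem single_mul_eq_sum (i j : ν) (c : C) (N : Matrix ν ν C) :
    Matrix.single i j c * N = ∑ a, Matrix.single i a (c * N j a) := by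
  ext b b'
  simp [Matrix.mul_apply, Matrix.sum_apply, Matrix.single_apply, ite_and]

theorem scalar_mul_single (c : C) (i j : ν) (x : C) :
    Matrix.scalar ν c * Matrix.single i j x = Matrix.single i j (c * x) := by
  ext a b
  simp [Matrix.single_apply]

theorem openContraction_decomposeFin_symm_zero (M : Fin (d + 1) → Matrix ν ν C)
    (σ : Equiv.Perm (Fin (d + 1))) :
    openContraction M (Equiv.Perm.decomposeFin.symm (0, σ)) =
      Matrix.scalar ν (M 0).trace * openContraction (Fin.tail M) σ := by
  rw [openContraction_succ_eq_sum_cons]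
  simp only [cons_comp_decomposeFin_symm_zero, slotMatrix_cons, Matrix.trace, Matrix.diag_apply,
    map_sum, ← Finset.sum_mul, ← Finset.mul_sum, openContraction]

variable {C : Type*} [Ring C] [Algebra ℂ C] {𝒞 : ZMod 2 → Submodule ℂ C} {p : Fin (d + 1) → ZMod 2}
  {M : Fin (d + 1) → Matrix ν ν C}

theorem openContraction_decomposeFin_symm_last [GradedAlgebra 𝒞] (h𝒞 : IsSuperComm 𝒞)
    (hM : ∀ i a b, M i a b ∈ 𝒞 (p i)) (σ : Equiv.Perm (Fin (d + 1))) :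
    openContraction M (Equiv.Perm.decomposeFin.symm ((σ (Fin.last d)).succ, σ)) =
      (-1 : ℤˣ) ^ (p 0 * (List.ofFn (Fin.tail p)).sum) •
        (openContraction (Fin.tail M) σ * M 0) := by
  rw [openContraction_succ_eq_sum_cons, openContraction, Finset.sum_mul, Finset.smul_sum]
  refine Finset.sum_congr rfl fun k _ => ?_
  simp only [cons_comp_decomposeFin_symm_succ, slotMatrix_cons, slotMatrix_update_last,
    scalar_mul_single]
  rw [slotMatrix, single_mul_eq_sum, Finset.smul_sum]
  refine Finset.sum_congr rfl fun a _ => ?_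
  rw [Matrix.smul_single]
  exact congrArg _ (h𝒞.mul_prod_ofFn (hM 0 _ a) fun i => hM i.succ _ _)

theorem openContraction_decomposeFin_symm_castSucc (h𝒞 : IsSuperComm 𝒞)
    (hM : ∀ i a b, M i a b ∈ 𝒞 (p i)) (σ : Equiv.Perm (Fin (d + 1))) (i : Fin d) :
    openContraction M (Equiv.Perm.decomposeFin.symm ((σ i.castSucc).succ, σ)) =
      (-1 : ℤˣ) ^ (p 0 * ((List.ofFn (Fin.tail p)).take i).sum) •
        openContraction (Function.update (Fin.tail M) i (M 0 * M i.succ)) σ := by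
  rw [openContraction_succ_eq_sum_cons, openContraction, Finset.smul_sum]
  refine Finset.sum_congr rfl fun k _ => ?_
  simp only [cons_comp_decomposeFin_symm_succ, slotMatrix_cons, slotMatrix_update_castSucc,
    scalar_mul_single]
  rw [slotMatrix_update_mul, Finset.smul_sum]
  refine Finset.sum_congr rfl fun a _ => ?_
  rw [Matrix.smul_single]
  refine congrArg _ ?_
  exact h𝒞.mul_prod_ofFn_update (hM 0 _ a) (fun j => hM j.succ _ _) i _

end OpenContraction

section TraceSpan

variable {R C ν : Type*} [CommSemiring R] [Semiring C] [Algebra R C] [Fintype ν]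

variable (R) in
/-- The subalgebra generated by the traces of the elements of a monoid of matrices. -/
def traceAlgebra [DecidableEq ν] (𝓜 : Submonoid (Matrix ν ν C)) : Subalgebra R C :=
  Algebra.adjoin R (Matrix.trace '' (𝓜 : Set (Matrix ν ν C)))

variable [DecidableEq ν] {𝓜 : Submonoid (Matrix ν ν C)}

variable (R 𝓜) in
/-- The left module over `traceAlgebra R 𝓜`, as scalar matrices, generated by a monoid `𝓜` of
matrices. -/
def traceSpan : Submodule R (Matrix ν ν C) :=
  Subalgebra.toSubmodule ((traceAlgebra R 𝓜).map (Matrix.scalarAlgHom ν R)) *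
    Submodule.span R 𝓜

theorem trace_mem_traceAlgebra {M : Matrix ν ν C} (hM : M ∈ 𝓜) : M.trace ∈ traceAlgebra R 𝓜 :=
  Algebra.subset_adjoin (Set.mem_image_of_mem _ hM)

theorem one_mem_traceSpan : 1 ∈ traceSpan R 𝓜 :=
  mul_one (1 : Matrix ν ν C) ▸ Submodule.mul_mem_mul
    (Subalgebra.one_mem ((traceAlgebra R 𝓜).map (Matrix.scalarAlgHom ν R)))
    (Submodule.subset_span 𝓜.one_mem)

theorem scalar_mul_mem_traceSpan {t : C} (ht : t ∈ traceAlgebra R 𝓜) {N : Matrix ν ν C}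
    (hN : N ∈ traceSpan R 𝓜) : Matrix.scalar ν t * N ∈ traceSpan R 𝓜 := by
  have scalar_mem : Matrix.scalar ν t ∈
      Subalgebra.toSubmodule ((traceAlgebra R 𝓜).map (Matrix.scalarAlgHom ν R)) := ⟨t, ht, rfl⟩
  have mul_mem := Submodule.mul_mem_mul scalar_mem hN
  rwa [traceSpan, ← mul_assoc, (Subalgebra.isIdempotentElem_toSubmodule _).eq] at mul_mem

theorem mul_mem_traceSpan {N M : Matrix ν ν C} (hN : N ∈ traceSpan R 𝓜) (hM : M ∈ 𝓜) :
    N * M ∈ traceSpan R 𝓜 := by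
  have mul_mem := Submodule.mul_mem_mul hN (Submodule.subset_span (R := R) hM)
  rwa [traceSpan, mul_assoc, Submodule.span_mul_span, 𝓜.coe_mul_self_eq] at mul_mem

theorem trace_scalar_mul (t : C) (N : Matrix ν ν C) :
    (Matrix.scalar ν t * N).trace = t * N.trace := by
  simp [Matrix.trace, Finset.mul_sum]

theorem trace_mem_traceAlgebra_of_mem_span {N : Matrix ν ν C} (hN : N ∈ Submodule.span R 𝓜) :
    N.trace ∈ traceAlgebra R 𝓜 := by
  have span_le : Submodule.span R 𝓜 ≤ (Subalgebra.toSubmodule (traceAlgebra R 𝓜)).comap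
      (Matrix.traceLinearMap ν R C) :=
    Submodule.span_le.2 fun _ hM => trace_mem_traceAlgebra hM
  exact span_le hN

theorem trace_mem_traceAlgebra_of_mem_traceSpan {N : Matrix ν ν C} (hN : N ∈ traceSpan R 𝓜) :
    N.trace ∈ traceAlgebra R 𝓜 := by
  induction hN using Submodule.mul_induction_on' with
  | mem_mul_mem T hT M hM =>
    obtain ⟨t, ht, rfl⟩ := Subalgebra.mem_map.1 hT
    exact (trace_scalar_mul t M).symm ▸ mul_mem ht (trace_mem_traceAlgebra_of_mem_span hM)
  | add N _ N' _ hN hN' => exact Matrix.trace_add N N' ▸ add_mem hN hN'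

theorem scalar_mem_of_forall_scalar_trace_mem {𝒜 : Subalgebra R (Matrix ν ν C)}
    (h𝒜 : ∀ M ∈ 𝓜, Matrix.scalar ν M.trace ∈ 𝒜) {t : C} (ht : t ∈ traceAlgebra R 𝓜) :
    Matrix.scalar ν t ∈ 𝒜 := by
  have adjoin_le : traceAlgebra R 𝓜 ≤ 𝒜.comap (Matrix.scalarAlgHom ν R) :=
    Algebra.adjoin_le (by rintro _ ⟨M, hM, rfl⟩; exact h𝒜 M hM)
  exact adjoin_le ht

theorem traceSpan_le {𝒜 : Subalgebra R (Matrix ν ν C)}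
    (h𝒜 : ∀ M ∈ 𝓜, Matrix.scalar ν M.trace ∈ 𝒜) (h𝓜 : 𝓜 ≤ 𝒜.toSubmonoid) :
    traceSpan R 𝓜 ≤ Subalgebra.toSubmodule 𝒜 := by
  have span_le : Submodule.span R 𝓜 ≤ Subalgebra.toSubmodule 𝒜 := Submodule.span_le.2 h𝓜
  refine Submodule.mul_le.2 fun T hT M hM => 𝒜.mul_mem ?_ (span_le hM)
  obtain ⟨t, ht, rfl⟩ := Subalgebra.mem_map.1 hT
  exact scalar_mem_of_forall_scalar_trace_mem h𝒜 ht

end TraceSpan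

theorem IsSuperComm.openContraction_mem_traceSpan {C ν : Type*} [Ring C] [Algebra ℂ C] [Fintype ν]
    [DecidableEq ν] {𝒞 : ZMod 2 → Submodule ℂ C} [GradedAlgebra 𝒞] (h𝒞 : IsSuperComm 𝒞)
    {𝓜 : Submonoid (Matrix ν ν C)} (h𝓜 : ∀ M ∈ 𝓜, ∃ p, ∀ a b, M a b ∈ 𝒞 p) {d : ℕ}
    {M : Fin d → Matrix ν ν C} (hM : ∀ i, M i ∈ 𝓜) (σ : Equiv.Perm (Fin (d + 1))) :
    openContraction M σ ∈ traceSpan ℂ 𝓜 := by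
  induction d with
  | zero => exact openContraction_fin_zero M σ ▸ one_mem_traceSpan
  | succ d ih =>
    choose p hp using fun i => h𝓜 _ (hM i)
    obtain ⟨⟨j, σ⟩, rfl⟩ := Equiv.Perm.decomposeFin.symm.surjective σ
    cases j using Fin.cases with
    | zero =>
      rw [openContraction_decomposeFin_symm_zero]
      exact scalar_mul_mem_traceSpan (trace_mem_traceAlgebra (hM 0)) (ih (fun i => hM i.succ) σ)
    | succ j =>
      obtain ⟨i, rfl⟩ := σ.surjective j
      cases i using Fin.lastCases with
      | last =>
        rw [openContraction_decomposeFin_symm_last h𝒞 hp, Units.smul_def]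
        exact zsmul_mem (mul_mem_traceSpan (ih (fun i => hM i.succ) σ) (hM 0)) _
      | cast i =>
        rw [openContraction_decomposeFin_symm_castSucc h𝒞 hp, Units.smul_def]
        refine zsmul_mem (ih (fun j => ?_) σ) _
        obtain rfl | hj := eq_or_ne j i
        · simpa using mul_mem (hM 0) (hM j.succ)
        · simpa [hj, Fin.tail] using hM j.succ

section Slots

theorem sum_snoc {ν N : Type*} [Fintype ν] {d : ℕ} [AddCommMonoid N] (F : (Fin (d + 1) → ν) → N) :
    ∑ h, F h = ∑ h : Fin d → ν, ∑ a, F (Fin.snoc h a) := by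
  rw [← (Fin.snocEquiv fun _ => ν).sum_comp, Fintype.sum_prod_type, Finset.sum_comm]
  rfl

variable {R C ν ω : Type*} [CommSemiring R] [Semiring C] [Algebra R C] [DecidableEq ν] {d : ℕ}

theorem eventually_mem_span_pow_of_mem_adjoin {A : Type*} [Semiring A] [Algebra R A] {X : Set A}
    (h1 : 1 ∈ X) {s : A} (hs : s ∈ Algebra.adjoin R X) :
    ∀ᶠ d in Filter.atTop, s ∈ Submodule.span R X ^ d := by
  have pow_mono {c d : ℕ} (h : c ≤ d) :=
    pow_le_pow_right' (Submodule.one_le.2 (Submodule.subset_span (R := R) h1)) h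
  suffices ∃ d : ℕ, s ∈ Submodule.span R X ^ d by
    obtain ⟨d₀, hd₀⟩ := this
    exact Filter.eventually_atTop.2 ⟨d₀, fun d hd => pow_mono hd hd₀⟩
  induction hs using Algebra.adjoin_induction with
  | mem x hx => exact ⟨1, by simpa using Submodule.subset_span hx⟩
  | algebraMap r => exact ⟨0, by simp⟩
  | add x y _ _ hx hy =>
    obtain ⟨c, hc⟩ := hx
    obtain ⟨d, hd⟩ := hy
    exact ⟨max c d, add_mem (pow_mono (le_max_left c d) hc) (pow_mono (le_max_right c d) hd)⟩
  | mul x y _ _ hx hy =>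
    obtain ⟨c, hc⟩ := hx
    obtain ⟨d, hd⟩ := hy
    exact ⟨c + d, pow_add (Submodule.span R X) c d ▸ Submodule.mul_mem_mul hc hd⟩

theorem single_mem_span_range_slotMatrix (A : ω → Matrix ν ν C) {s : C}
    (hs : s ∈ Submodule.span R (Set.range fun q : ω × ν × ν => A q.1 q.2.1 q.2.2) ^ d) (a b : ν) :
    Matrix.single a b s ∈ Submodule.span R
      (Set.range fun q : (Fin d → ω) × (Fin (d + 1) → ν) × (Fin (d + 1) → ν) =>
        slotMatrix (A ∘ q.1) q.2.1 q.2.2) := by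
  have single_mem := Submodule.mem_map_of_mem (f := Matrix.singleLinearMap R a b) hs
  rw [Submodule.span_pow, ← Submodule.span_image] at single_mem
  refine Submodule.span_mono ?_ single_mem
  rintro _ ⟨x, hx, rfl⟩
  obtain ⟨y, rfl⟩ := Set.mem_pow.1 hx
  choose q hq using fun i => (y i).2
  refine ⟨(fun i => (q i).1, Fin.snoc (fun i => (q i).2.1) b, Fin.snoc (fun i => (q i).2.2) a), ?_⟩
  simp only [slotMatrix, Fin.snoc_last, Fin.snoc_castSucc, Function.comp_apply, hq]
  rfl

theorem exists_mem_span_range_slotMatrix [Finite ν] {A : ω → Matrix ν ν C}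
    (h1 : ∃ w a b, A w a b = 1) (hA : Algebra.adjoin R
      (Set.range fun q : ω × ν × ν => A q.1 q.2.1 q.2.2) = ⊤) (N : Matrix ν ν C) :
    ∃ d : ℕ, N ∈ Submodule.span R
      (Set.range fun q : (Fin d → ω) × (Fin (d + 1) → ν) × (Fin (d + 1) → ν) =>
        slotMatrix (A ∘ q.1) q.2.1 q.2.2) := by
  cases nonempty_fintype ν
  obtain ⟨w, i, j, hw⟩ := h1
  have entries_mem : ∀ᶠ d in Filter.atTop, ∀ a b,
      N a b ∈ Submodule.span R (Set.range fun q : ω × ν × ν => A q.1 q.2.1 q.2.2) ^ d := by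
    simp only [Filter.eventually_all]
    exact fun a b => eventually_mem_span_pow_of_mem_adjoin (Set.mem_range.2 ⟨(w, i, j), hw⟩)
      (hA ▸ Algebra.mem_top)
  obtain ⟨d, hd⟩ := entries_mem.exists
  refine ⟨d, ?_⟩
  rw [Matrix.matrix_eq_sum_single N]
  exact sum_mem fun a _ => sum_mem fun b _ => single_mem_span_range_slotMatrix A (hd a b) a b

variable [Fintype ν]

theorem mapMatrix_mul_mul_mapMatrix_apply (A B : Matrix ν ν R) (M : Matrix ν ν C) (h k : ν) :
    ((Algebra.ofId R C).mapMatrix A * M * (Algebra.ofId R C).mapMatrix B) h k =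
      ∑ a, ∑ b, (A h a * B b k) • M a b := by
  simp only [Matrix.mul_apply, Finset.sum_mul, AlgHom.mapMatrix_apply, Matrix.map_apply,
    Algebra.ofId_apply]
  rw [Finset.sum_comm]
  refine Finset.sum_congr rfl fun a _ => Finset.sum_congr rfl fun b _ => ?_
  rw [← Algebra.smul_def, ← Algebra.commutes, ← Algebra.smul_def, smul_smul, mul_comm]

theorem mapMatrix_mul_single_mul_mapMatrix (A B : Matrix ν ν R) (h k : ν) (x : C) :
    (Algebra.ofId R C).mapMatrix B * Matrix.single k h x * (Algebra.ofId R C).mapMatrix A =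
      ∑ a, ∑ b, (A h a * B b k) • Matrix.single b a x := by
  ext i j
  rw [mapMatrix_mul_mul_mapMatrix_apply]
  simp [Matrix.sum_apply, Matrix.single_apply, ite_and, Finset.sum_ite_irrel, mul_comm]

theorem prod_ofFn_mapMatrix_mul_mul_mapMatrix (A B : Matrix ν ν R) (M : Fin d → Matrix ν ν C)
    (h k : Fin d → ν) :
    (List.ofFn fun i => ((Algebra.ofId R C).mapMatrix A * M i * (Algebra.ofId R C).mapMatrix B)
      (h i) (k i)).prod = ∑ a : Fin d → ν, ∑ b : Fin d → ν,
        (tensorPow (Fin d) A h a * tensorPow (Fin d) B b k) •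
          (List.ofFn fun i => M i (a i) (b i)).prod := by
  simp only [mapMatrix_mul_mul_mapMatrix_apply, ← MultilinearMap.mkPiAlgebraFin_apply (R := R),
    MultilinearMap.map_sum, MultilinearMap.map_smul_univ, tensorPow_apply, Finset.prod_mul_distrib]

theorem mapMatrix_mul_slotMatrix_mul_mapMatrix (A B : Matrix ν ν R) (M : Fin d → Matrix ν ν C)
    (h k : Fin (d + 1) → ν) :
    (Algebra.ofId R C).mapMatrix B * slotMatrix (fun i => (Algebra.ofId R C).mapMatrix A * M i *
      (Algebra.ofId R C).mapMatrix B) h k * (Algebra.ofId R C).mapMatrix A =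
        ∑ a, ∑ b, (tensorPow (Fin (d + 1)) A h a * tensorPow (Fin (d + 1)) B b k) •
          slotMatrix M a b := by
  have single_sum (i j : ν) (F : (Fin d → ν) → (Fin d → ν) → C) :
      Matrix.single i j (∑ a, ∑ b, F a b) = ∑ a, ∑ b, Matrix.single i j (F a b) := by
    simp only [← Matrix.singleAddMonoidHom_apply, map_sum]
  rw [slotMatrix, prod_ofFn_mapMatrix_mul_mul_mapMatrix, mapMatrix_mul_single_mul_mapMatrix]
  simp only [sum_snoc, single_sum, Finset.smul_sum, slotMatrix, tensorPow_apply,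
    Fin.prod_univ_castSucc, Fin.snoc_castSucc, Fin.snoc_last, ← Matrix.smul_single, smul_smul]
  calc _ = _ := Finset.sum_congr rfl fun a₀ _ => Finset.sum_comm
    _ = _ := Finset.sum_comm
    _ = _ := Finset.sum_congr rfl fun a _ => Finset.sum_congr rfl fun a₀ _ => Finset.sum_comm
    _ = _ := Finset.sum_congr rfl fun a _ => Finset.sum_congr rfl fun a₀ _ =>
      Finset.sum_congr rfl fun b _ => Finset.sum_congr rfl fun b₀ _ => congrArg (· • _) (by ring)

theorem mapMatrix_slotMatrix (φ : C →ₐ[R] C) (M : Fin d → Matrix ν ν C) (h k : Fin (d + 1) → ν) :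
    φ.mapMatrix (slotMatrix M h k) = slotMatrix (fun i => φ.mapMatrix (M i)) h k := by
  simp only [slotMatrix, AlgHom.mapMatrix_apply, Matrix.map_single, map_list_prod, List.map_ofFn]
  rfl

end Slots

section SlotSum

variable {R C ν ω : Type*} [CommSemiring R] [Semiring C] [Algebra R C] [Fintype ν] [DecidableEq ν]
  [Fintype ω] {d : ℕ}

variable (R) in
/-- The linear combination of slot matrices with words `w` in a family `A` of matrices, the slot
matrices with a given word being weighted by the entries of a matrix over `R`: the pairing through
which conjugation by matrices over `R` is moved from the slots to the coefficients. -/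
def slotSum (A : ω → Matrix ν ν C) (d : ℕ) :
    ((Fin d → ω) → Matrix (Fin (d + 1) → ν) (Fin (d + 1) → ν) R) →ₗ[R] Matrix ν ν C :=
  ∑ w, ∑ k, ∑ h, (Matrix.entryLinearMap R R k h ∘ₗ LinearMap.proj w).smulRight
    (slotMatrix (A ∘ w) h k)

theorem slotSum_apply (A : ω → Matrix ν ν C)
    (c : (Fin d → ω) → Matrix (Fin (d + 1) → ν) (Fin (d + 1) → ν) R) :
    slotSum R A d c = ∑ w, ∑ k, ∑ h, c w k h • slotMatrix (A ∘ w) h k := by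
  simp [slotSum, LinearMap.sum_apply]

theorem slotSum_single_placePerm [DecidableEq ω] (A : ω → Matrix ν ν C)
    (w : Fin d → ω) (σ : Equiv.Perm (Fin (d + 1))) :
    slotSum R A d (Pi.single w (placePerm R (Fin (d + 1)) ν σ)) = openContraction (A ∘ w) σ := by
  rw [slotSum_apply, Finset.sum_eq_single w (fun v _ hv => by simp [Pi.single_eq_of_ne hv])
    (fun h => absurd (Finset.mem_univ w) h)]
  simp [placePerm_apply, openContraction]

theorem mem_range_slotSum {A : ω → Matrix ν ν C} {N : Matrix ν ν C}
    (hN : N ∈ Submodule.span R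
      (Set.range fun q : (Fin d → ω) × (Fin (d + 1) → ν) × (Fin (d + 1) → ν) =>
        slotMatrix (A ∘ q.1) q.2.1 q.2.2)) : N ∈ LinearMap.range (slotSum R A d) := by
  obtain ⟨c, rfl⟩ := Submodule.mem_span_range_iff_exists_fun R |>.1 hN
  refine ⟨fun w => .of fun k h => c (w, h, k), ?_⟩
  simp only [slotSum_apply, Fintype.sum_prod_type, Matrix.of_apply]
  exact Finset.sum_congr rfl fun w _ => Finset.sum_comm

theorem slotSum_tensorPow_mul_mul_tensorPow {A : ω → Matrix ν ν C} {P Q : Matrix ν ν R}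
    {φ : C →ₐ[R] C} (hA : ∀ x, φ.mapMatrix (A x) =
      (Algebra.ofId R C).mapMatrix Q * A x * (Algebra.ofId R C).mapMatrix P)
    (c : (Fin d → ω) → Matrix (Fin (d + 1) → ν) (Fin (d + 1) → ν) R) :
    slotSum R A d (fun w => tensorPow (Fin (d + 1)) P * c w * tensorPow (Fin (d + 1)) Q) =
      (Algebra.ofId R C).mapMatrix P * φ.mapMatrix (slotSum R A d c) *
        (Algebra.ofId R C).mapMatrix Q := by
  have map_slotMatrix (w : Fin d → ω) (h k : Fin (d + 1) → ν) :
      (Algebra.ofId R C).mapMatrix P * φ.mapMatrix (slotMatrix (A ∘ w) h k) *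
        (Algebra.ofId R C).mapMatrix Q =
      ∑ a, ∑ b, (tensorPow (Fin (d + 1)) Q h a * tensorPow (Fin (d + 1)) P b k) •
        slotMatrix (A ∘ w) a b := by
    simp only [mapMatrix_slotMatrix, Function.comp_apply, hA]
    exact mapMatrix_mul_slotMatrix_mul_mapMatrix Q P (A ∘ w) h k
  simp only [slotSum_apply, map_sum, map_smul, Finset.mul_sum, Finset.sum_mul, mul_smul_comm,
    smul_mul_assoc, map_slotMatrix]
  refine Finset.sum_congr rfl fun w _ => ?_
  simp only [Matrix.mul_apply, Finset.sum_mul, Finset.sum_smul, Finset.smul_sum, smul_smul]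
  calc _ = _ := Finset.sum_comm_cycle
    _ = _ := Finset.sum_congr rfl fun _ _ => Finset.sum_comm_cycle
    _ = _ := Finset.sum_comm
    _ = _ := Finset.sum_congr rfl fun k _ => Finset.sum_congr rfl fun h _ => Finset.sum_comm
    _ = _ := Finset.sum_congr rfl fun k _ => Finset.sum_congr rfl fun h _ =>
      Finset.sum_congr rfl fun a _ => Finset.sum_congr rfl fun b _ => congrArg (· • _) (by ring)

end SlotSum

theorem IsSuperComm.mem_traceSpan_of_forall_GL_fixed {C ν ω : Type*} [Ring C] [Algebra ℂ C]
    [Fintype ν] [DecidableEq ν] [Finite ω] {𝒞 : ZMod 2 → Submodule ℂ C} [GradedAlgebra 𝒞]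
    (h𝒞 : IsSuperComm 𝒞) {𝓜 : Submonoid (Matrix ν ν C)}
    (h𝓜 : ∀ M ∈ 𝓜, ∃ p, ∀ a b, M a b ∈ 𝒞 p) {A : ω → Matrix ν ν C} (hA𝓜 : ∀ x, A x ∈ 𝓜)
    (hA : Algebra.adjoin ℂ (Set.range fun q : ω × ν × ν => A q.1 q.2.1 q.2.2) = ⊤)
    {φ : GL ν ℂ → C →ₐ[ℂ] C} (hφ : ∀ g x, (φ g).mapMatrix (A x) =
      (Algebra.ofId ℂ C).mapMatrix g⁻¹.val * A x * (Algebra.ofId ℂ C).mapMatrix g.val)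
    {N : Matrix ν ν C} (hN : ∀ g, (Algebra.ofId ℂ C).mapMatrix g.val * (φ g).mapMatrix N *
      (Algebra.ofId ℂ C).mapMatrix g⁻¹.val = N) : N ∈ traceSpan ℂ 𝓜 := by
  classical
  cases nonempty_fintype ω
  obtain _ | ⟨⟨i⟩⟩ := isEmpty_or_nonempty ν
  · exact Subsingleton.elim 0 N ▸ zero_mem _
  -- Adjoining the identity to the family makes all entries combinations of products of one length.
  let A₁ : Option ω → Matrix ν ν C := fun o => o.elim 1 A
  have A₁_mem (o : Option ω) : A₁ o ∈ 𝓜 := o.rec 𝓜.one_mem hA𝓜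
  have adjoin_A₁ :
      Algebra.adjoin ℂ (Set.range fun q : Option ω × ν × ν => A₁ q.1 q.2.1 q.2.2) = ⊤ :=
    top_le_iff.1 <| hA ▸ Algebra.adjoin_mono
      (Set.range_subset_iff.2 fun q => ⟨(some q.1, q.2), rfl⟩)
  have map_A₁ (g : GL ν ℂ) (o : Option ω) : (φ g).mapMatrix (A₁ o) =
      (Algebra.ofId ℂ C).mapMatrix g⁻¹.val * A₁ o * (Algebra.ofId ℂ C).mapMatrix g.val := by
    cases o with
    | none => simp only [A₁, Option.elim_none, map_one, mul_one, ← map_mul, ← Units.val_mul,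
        inv_mul_cancel, Units.val_one]
    | some x => exact hφ g x
  obtain ⟨d, hd⟩ := exists_mem_span_range_slotMatrix ⟨none, i, i, Matrix.one_apply_eq i⟩ adjoin_A₁ N
  have N_mem_span := mem_span_range_single_placePerm (Γ := fun g M =>
    (Algebra.ofId ℂ C).mapMatrix g.val * (φ g).mapMatrix M * (Algebra.ofId ℂ C).mapMatrix g⁻¹.val)
    (fun g c => slotSum_tensorPow_mul_mul_tensorPow (map_A₁ g) c) (mem_range_slotSum hd) hN
  refine Submodule.span_le.2 ?_ N_mem_span
  rintro _ ⟨⟨w, σ⟩, rfl⟩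
  simpa only [slotSum_single_placePerm, SetLike.mem_coe, Function.comp_def] using
    h𝒞.openContraction_mem_traceSpan h𝓜 (fun i => A₁_mem (w i)) σ

section Generators

theorem adjoin_range_symmetricAlgebra_ι {R M : Type*} [CommSemiring R] [AddCommMonoid M]
    [Module R M] : Algebra.adjoin R (Set.range (SymmetricAlgebra.ι R M)) = ⊤ := by
  refine top_le_iff.1 fun s _ => ?_
  induction s using SymmetricAlgebra.induction with
  | algebraMap r => exact Subalgebra.algebraMap_mem _ r
  | ι w => exact Algebra.subset_adjoin ⟨w, rfl⟩
  | mul a b ha hb => exact mul_mem (ha trivial) (hb trivial)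
  | add a b ha hb => exact add_mem (ha trivial) (hb trivial)

theorem SuperSym.adjoin_range_ι (W₀ W₁ : Type*) [AddCommGroup W₀] [Module ℂ W₀]
    [AddCommGroup W₁] [Module ℂ W₁] :
    Algebra.adjoin ℂ (Set.range (SuperSym.ιEven W₀ W₁) ∪ Set.range (SuperSym.ιOdd W₀ W₁)) = ⊤ := by
  have adjoin_range_ιEven : Algebra.adjoin ℂ (Set.range (SuperSym.ιEven W₀ W₁)) =
      (Algebra.TensorProduct.includeLeft : _ →ₐ[ℂ] SuperSym W₀ W₁).range := by
    rw [← Algebra.map_top, ← adjoin_range_symmetricAlgebra_ι, AlgHom.map_adjoin, ← Set.range_comp]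
    rfl
  have adjoin_range_ιOdd : Algebra.adjoin ℂ (Set.range (SuperSym.ιOdd W₀ W₁)) =
      (Algebra.TensorProduct.includeRight : _ →ₐ[ℂ] SuperSym W₀ W₁).range := by
    rw [← Algebra.map_top, ← CliffordAlgebra.adjoin_range_ι, AlgHom.map_adjoin, ← Set.range_comp]
    rfl
  have map_range := Algebra.TensorProduct.map_range (AlgHom.id ℂ (SymmetricAlgebra ℂ W₀))
    (AlgHom.id ℂ (ExteriorAlgebra ℂ W₁))
  rw [Algebra.adjoin_union, adjoin_range_ιEven, adjoin_range_ιOdd]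
  rw [Algebra.TensorProduct.map_id, AlgHom.comp_id, AlgHom.comp_id] at map_range
  exact map_range.symm.trans (AlgHom.range_eq_top _ |>.2 Function.surjective_id)

variable {n : ℕ} (e f : ℕ)

theorem dual_eq_sum_coordFun {m : ℕ} (φ : Module.Dual ℂ (MatTuple n m)) :
    φ = ∑ i, ∑ h, ∑ k, φ (Pi.single i (Matrix.single h k 1)) • coordFun i h k := by
  refine LinearMap.pi_ext' fun i => Matrix.ext_linearMap _ fun h k => LinearMap.ext_ring ?_
  simp [coordFun, Pi.single_apply, Matrix.single_apply, apply_ite, ite_and,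
    Finset.sum_ite_irrel]

theorem adjoin_range_genericMatrix_apply : Algebra.adjoin ℂ
    (Set.range fun q : (Fin e ⊕ Fin f) × Fin n × Fin n => genericMatrix n e f q.1 q.2.1 q.2.2) =
      ⊤ := by
  set 𝒮 := Algebra.adjoin ℂ (Set.range fun q : (Fin e ⊕ Fin f) × Fin n × Fin n =>
    genericMatrix n e f q.1 q.2.1 q.2.2)
  have entry_mem (x : Fin e ⊕ Fin f) (h k : Fin n) : genericMatrix n e f x h k ∈ 𝒮 :=
    Algebra.subset_adjoin (Set.mem_range.2 ⟨(x, h, k), rfl⟩)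
  rw [← top_le_iff, ← SuperSym.adjoin_range_ι, Algebra.adjoin_le_iff]
  rintro _ (⟨φ, rfl⟩ | ⟨φ, rfl⟩) <;> rw [dual_eq_sum_coordFun φ] <;> simp only [map_sum, map_smul]
  · exact sum_mem fun i _ => sum_mem fun h _ => sum_mem fun k _ =>
      𝒮.smul_mem (entry_mem (Sum.inl i) h k) _
  · exact sum_mem fun j _ => sum_mem fun h _ => sum_mem fun k _ =>
      𝒮.smul_mem (entry_mem (Sum.inr j) h k) _

end Generators

section Equivariance

variable {n e f : ℕ}

theorem dualAct_coordFun {m : ℕ} (g : GL (Fin n) ℂ) (i : Fin m) (h k : Fin n) :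
    dualAct m g (coordFun i h k) = ∑ a, ∑ b, (g⁻¹.val h a * g.val b k) • coordFun i a b := by
  refine LinearMap.ext fun A => ?_
  have apply_eq : dualAct m g (coordFun i h k) A = (g⁻¹.val * A i * g⁻¹⁻¹.val) h k := rfl
  rw [apply_eq, inv_inv]
  simp only [Matrix.mul_apply, Finset.sum_mul, LinearMap.sum_apply, LinearMap.smul_apply]
  rw [Finset.sum_comm]
  exact Finset.sum_congr rfl fun a _ => Finset.sum_congr rfl fun b _ => mul_right_comm _ _ _

theorem actS_ιEven (g : GL (Fin n) ℂ) (φ : Module.Dual ℂ (MatTuple n e)) :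
    actS e f g (SuperSym.ιEven _ _ φ) = SuperSym.ιEven _ _ (dualAct e g φ) := by
  simp [actS, SuperSym.ιEven]

theorem actS_ιOdd (g : GL (Fin n) ℂ) (φ : Module.Dual ℂ (MatTuple n f)) :
    actS e f g (SuperSym.ιOdd _ _ φ) = SuperSym.ιOdd _ _ (dualAct f g φ) := by
  simp [actS, SuperSym.ιOdd]

theorem mapMatrix_actS_genericMatrix (g : GL (Fin n) ℂ) (x : Fin e ⊕ Fin f) :
    (actS e f g).mapMatrix (genericMatrix n e f x) =
      constMat e f g⁻¹.val * genericMatrix n e f x * constMat e f g.val := by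
  ext h k
  rw [mapMatrix_mul_mul_mapMatrix_apply]
  cases x with
  | inl i =>
    refine (actS_ιEven g (coordFun i h k)).trans ?_
    simp only [dualAct_coordFun, map_sum, map_smul]
    rfl
  | inr j =>
    refine (actS_ιOdd g (coordFun j h k)).trans ?_
    simp only [dualAct_coordFun, map_sum, map_smul]
    rfl

theorem mem_equivariants_iff {M : Matrix (Fin n) (Fin n) (InvAmbient n e f)} :
    M ∈ equivariants n e f ↔
      ∀ g, (actS e f g).mapMatrix M = constMat e f g⁻¹.val * M * constMat e f g.val := by
  refine forall_congr' fun g => ?_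
  let u := Units.map (MonoidHomClass.toMonoidHom (constMat e f)) g
  change u.val * (actS e f g).mapMatrix M * u⁻¹.val = M ↔ _ = u⁻¹.val * M * u.val
  rw [Units.mul_inv_eq_iff_eq_mul, mul_assoc, Units.eq_inv_mul_iff_mul_eq]

theorem genericMatrix_mem_equivariants (x : Fin e ⊕ Fin f) :
    genericMatrix n e f x ∈ equivariants n e f :=
  mem_equivariants_iff.2 fun g => mapMatrix_actS_genericMatrix g x

theorem trace_mapMatrix_mul_comm {R C ν : Type*} [CommSemiring R] [Semiring C]
    [Algebra R C] [Fintype ν] [DecidableEq ν] (A : Matrix ν ν R) (M : Matrix ν ν C) :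
    ((Algebra.ofId R C).mapMatrix A * M).trace = (M * (Algebra.ofId R C).mapMatrix A).trace := by
  simp only [Matrix.trace, Matrix.diag, Matrix.mul_apply, AlgHom.mapMatrix_apply, Matrix.map_apply,
    Algebra.ofId_apply, Algebra.commutes]
  exact Finset.sum_comm

theorem trace_mem_invariants {M : Matrix (Fin n) (Fin n) (InvAmbient n e f)}
    (hM : M ∈ equivariants n e f) : M.trace ∈ invariants n e f := by
  intro g
  calc actS e f g M.trace = ((actS e f g).mapMatrix M).trace :=
      AddMonoidHom.map_trace (actS e f g) M
    _ = (constMat e f g⁻¹.val * (M * constMat e f g.val)).trace := by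
      rw [mem_equivariants_iff.1 hM, mul_assoc]
    _ = M.trace := by
      rw [trace_mapMatrix_mul_comm, mul_assoc, constMat_mul_inv, mul_one]

theorem commute_scalar_mapMatrix {R C ν : Type*} [CommSemiring R] [Semiring C]
    [Algebra R C] [Fintype ν] [DecidableEq ν] (s : C) (A : Matrix ν ν R) :
    Commute (Matrix.scalar ν s) ((Algebra.ofId R C).mapMatrix A) := by
  ext h k
  simpa using (Algebra.commutes (A h k) s).symm

theorem scalar_mem_equivariants {s : InvAmbient n e f} (hs : s ∈ invariants n e f) :
    Matrix.scalar (Fin n) s ∈ equivariants n e f := by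
  refine mem_equivariants_iff.2 fun g => ?_
  rw [mul_assoc, commute_scalar_mapMatrix s g.val, ← mul_assoc, constMat_inv_mul, one_mul]
  have map_s : actS e f g s = s := hs g
  simp [Matrix.diagonal_map, map_s]

end Equivariance

section Evaluation

variable {n : ℕ} {C A : Type*} [Ring C] [Algebra ℂ C] [Ring A] [Algebra ℂ A]
  {𝒞 : ZMod 2 → Submodule ℂ C} [GradedAlgebra 𝒞] {𝒜 : ZMod 2 → Submodule ℂ A} [GradedAlgebra 𝒜]
  (hC : IsSuperComm 𝒞) (F : A →ₐ[ℂ] Matrix (Fin n) (Fin n) C)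
  (hF : ∀ ⦃i : ZMod 2⦄ ⦃a : A⦄, a ∈ 𝒜 i → ∀ h k, F a h k ∈ 𝒞 i)

theorem range_evalTraceAlg :
    (evalTraceAlg hC F hF).range = Algebra.adjoin ℂ (Set.range fun a => (F a).trace) := by
  refine le_antisymm ?_ (Algebra.adjoin_le ?_)
  · rw [← Algebra.map_top, ← SuperSym.adjoin_range_ι, AlgHom.map_adjoin, Algebra.adjoin_le_iff]
    rintro _ ⟨_, ⟨c, rfl⟩ | ⟨c, rfl⟩, rfl⟩ <;> obtain ⟨a, rfl⟩ := Submodule.mkQ_surjective _ c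
    · rw [evalTraceAlg, SuperSym.lift_ιEven]
      exact Algebra.subset_adjoin ⟨a, rfl⟩
    · rw [evalTraceAlg, SuperSym.lift_ιOdd]
      exact Algebra.subset_adjoin ⟨a, rfl⟩
  · rintro _ ⟨a, rfl⟩
    exact ⟨formalTrace 𝒜 a, evalTraceAlg_formalTrace hC F hF a⟩

theorem range_evalWithTrace : (evalWithTrace hC F hF).range =
    F.range ⊔ (evalTraceAlg hC F hF).range.map (Matrix.scalarAlgHom (Fin n) ℂ) := by
  refine le_antisymm ?_ (sup_le ?_ ?_)
  · rintro _ ⟨x, rfl⟩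
    change TensorProduct ℂ A (TraceAlg 𝒜) at x
    change evalWithTrace hC F hF x ∈ _
    induction x using TensorProduct.induction_on with
    | zero => exact (map_zero (evalWithTrace hC F hF)).symm ▸ zero_mem _
    | add x y hx hy => exact (map_add (evalWithTrace hC F hF) x y).symm ▸ add_mem hx hy
    | tmul a c =>
      exact mul_mem (show F a ∈ _ from Algebra.mem_sup_left ⟨a, rfl⟩)
        (show Matrix.scalar (Fin n) (evalTraceAlg hC F hF c) ∈ _ from
          Algebra.mem_sup_right ⟨_, ⟨c, rfl⟩, rfl⟩)
  · rintro _ ⟨a, rfl⟩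
    exact ⟨WithTrace.of 𝒜 a, evalWithTrace_of hC F hF a⟩
  · rintro _ ⟨_, ⟨c, rfl⟩, rfl⟩
    exact ⟨WithTrace.ofTraceAlg 𝒜 c, evalWithTrace_ofTraceAlg hC F hF c⟩

end Evaluation

section FundamentalTheorem

variable (n e f : ℕ)

/-- The monoid of the monomials in the generic matrices. -/
def genericMonoid : Submonoid (Matrix (Fin n) (Fin n) (InvAmbient n e f)) :=
  Submonoid.closure (Set.range (genericMatrix n e f))

theorem coe_genericMonoid : (genericMonoid n e f : Set _) = Set.range (genericMonomial n e f) := by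
  rw [genericMonoid, ← FreeMonoid.mrange_lift, MonoidHom.coe_mrange]
  exact congrArg Set.range (funext (FreeMonoid.lift_apply (genericMatrix n e f)))

theorem traceAlgebra_genericMonoid : traceAlgebra ℂ (genericMonoid n e f) =
    Algebra.adjoin ℂ (Set.range fun w => (genericMonomial n e f w).trace) := by
  rw [traceAlgebra, coe_genericMonoid, ← Set.range_comp]
  rfl

theorem range_evalFree :
    (evalFree n e f).range = Algebra.adjoin ℂ (Set.range (genericMatrix n e f)) := by
  refine le_antisymm ?_ (Algebra.adjoin_le ?_)
  · rintro _ ⟨a, rfl⟩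
    change evalFree n e f a ∈ _
    rw [evalFree, AddMonoidAlgebra.lift_apply, Finsupp.sum]
    exact sum_mem fun w _ => Subalgebra.smul_mem _ (list_prod_mem <| List.forall_mem_map.2
      fun x _ => Algebra.subset_adjoin (Set.mem_range_self x)) _
  · rintro _ ⟨x, rfl⟩
    exact ⟨AddMonoidAlgebra.single (FreeAddMonoid.of x) 1, by simp [evalFree, genericMonomial]⟩

theorem range_evalGenericTrace :
    (evalGenericTrace n e f).range = traceAlgebra ℂ (genericMonoid n e f) := by
  have range_evalFree_eq_span : Subalgebra.toSubmodule (evalFree n e f).range =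
      Submodule.span ℂ (genericMonoid n e f) := by
    rw [range_evalFree, Algebra.adjoin_eq_span]; rfl
  rw [evalGenericTrace, range_evalTraceAlg]
  refine le_antisymm (Algebra.adjoin_le ?_) (Algebra.adjoin_mono ?_)
  · rintro _ ⟨a, rfl⟩
    refine trace_mem_traceAlgebra_of_mem_span ?_
    rw [← range_evalFree_eq_span]
    exact ⟨a, rfl⟩
  · rintro _ ⟨M, hM, rfl⟩
    obtain ⟨a, rfl⟩ : M ∈ Subalgebra.toSubmodule (evalFree n e f).range :=
      range_evalFree_eq_span ▸ Submodule.subset_span hM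
    exact ⟨a, rfl⟩

theorem range_evalGeneric : (evalGeneric n e f).range = Algebra.adjoin ℂ
    ((Set.range fun w => Matrix.scalar (Fin n) (genericMonomial n e f w).trace) ∪
      Set.range (genericMatrix n e f)) := by
  have range_evalTraceAlg_eq := range_evalGenericTrace n e f
  rw [evalGenericTrace, traceAlgebra_genericMonoid] at range_evalTraceAlg_eq
  rw [evalGeneric, range_evalWithTrace, range_evalTraceAlg_eq, range_evalFree, AlgHom.map_adjoin,
    ← Set.range_comp, sup_comm, ← Algebra.adjoin_union]
  rfl

variable {n e f}

theorem genericMonoid_le_equivariants :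
    genericMonoid n e f ≤ (equivariants n e f).toSubmonoid :=
  Submonoid.closure_le.2 <| Set.range_subset_iff.2 genericMatrix_mem_equivariants

theorem equivariants_le_traceSpan :
    Subalgebra.toSubmodule (equivariants n e f) ≤ traceSpan ℂ (genericMonoid n e f) := by
  have homogeneous : ∀ M ∈ genericMonoid n e f, ∃ p, ∀ a b, M a b ∈ ambientGrading n e f p := by
    intro M hM
    rw [← SetLike.mem_coe, coe_genericMonoid] at hM
    obtain ⟨w, rfl⟩ := hM
    exact ⟨_, genericMonomial_mem n e f w⟩
  have genericMatrix_mem (x : Fin e ⊕ Fin f) : genericMatrix n e f x ∈ genericMonoid n e f :=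
    Submonoid.subset_closure (Set.mem_range_self x)
  intro M hM
  exact (SuperSym.isSuperComm _ _).mem_traceSpan_of_forall_GL_fixed homogeneous genericMatrix_mem
    (adjoin_range_genericMatrix_apply e f) mapMatrix_actS_genericMatrix hM

theorem traceAlgebra_genericMonoid_eq_invariants :
    traceAlgebra ℂ (genericMonoid n e f) = invariants n e f := by
  refine le_antisymm (Algebra.adjoin_le ?_) fun s hs => ?_
  · rintro _ ⟨M, hM, rfl⟩
    exact trace_mem_invariants (genericMonoid_le_equivariants hM)
  obtain rfl | hn := Nat.eq_zero_or_pos n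
  · have bot_eq_top : (⊥ : Subalgebra ℂ (InvAmbient 0 e f)) = ⊤ := by
      rw [← adjoin_range_genericMatrix_apply, Set.range_eq_empty, Algebra.adjoin_empty]
    exact (bot_eq_top ▸ bot_le : ⊤ ≤ traceAlgebra ℂ (genericMonoid 0 e f)) Algebra.mem_top
  · have trace_mem : (Matrix.scalar (Fin n) s).trace ∈ traceAlgebra ℂ (genericMonoid n e f) :=
      trace_mem_traceAlgebra_of_mem_traceSpan
        (equivariants_le_traceSpan (scalar_mem_equivariants hs))
    have trace_scalar : (Matrix.scalar (Fin n) s).trace = (n : ℂ) • s := by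
      simp [Matrix.trace, Nat.cast_smul_eq_nsmul]
    rw [trace_scalar, ← Subalgebra.mem_toSubmodule] at trace_mem
    exact ((Subalgebra.toSubmodule _).smul_mem_iff (Nat.cast_ne_zero.2 hn.ne')).1 trace_mem

theorem adjoin_trace_union_genericMatrix_eq_equivariants : Algebra.adjoin ℂ
    ((Set.range fun w => Matrix.scalar (Fin n) (genericMonomial n e f w).trace) ∪
      Set.range (genericMatrix n e f)) = equivariants n e f := by
  refine le_antisymm (Algebra.adjoin_le ?_) <| Subalgebra.toSubmodule.le_iff_le.1 <|
    equivariants_le_traceSpan.trans (traceSpan_le ?_ ?_)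
  · rintro _ (⟨w, rfl⟩ | ⟨x, rfl⟩)
    · refine scalar_mem_equivariants ?_
      rw [← traceAlgebra_genericMonoid_eq_invariants, traceAlgebra_genericMonoid]
      exact Algebra.subset_adjoin ⟨w, rfl⟩
    · exact genericMatrix_mem_equivariants x
  · intro M hM
    rw [← SetLike.mem_coe, coe_genericMonoid] at hM
    obtain ⟨w, rfl⟩ := hM
    exact Algebra.subset_adjoin (Or.inl ⟨w, rfl⟩)
  · refine Submonoid.closure_le.2 (Set.range_subset_iff.2 fun x => ?_)
    exact Algebra.subset_adjoin (Or.inr ⟨x, rfl⟩)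

end FundamentalTheorem

end

theorem mainTheorem2 (n e f : ℕ) :
    -- the evaluation of the free superalgebra with trace surjects onto the invariants
    (evalGeneric n e f).range = equivariants n e f ∧
    (evalGenericTrace n e f).range = invariants n e f ∧
    -- the invariants are generated by the traces of monomials in the generic matrices
    Algebra.adjoin ℂ (Set.range fun w : List (Fin e ⊕ Fin f) => (genericMonomial n e f w).trace) =
      invariants n e f ∧
    -- the equivariant maps are generated by these traces and by the generic matrices
    Algebra.adjoin ℂ
      ((Set.range fun w : List (Fin e ⊕ Fin f) =>
          Matrix.scalar (Fin n) (genericMonomial n e f w).trace) ∪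
        Set.range (genericMatrix n e f)) = equivariants n e f :=
  ⟨(range_evalGeneric n e f).trans adjoin_trace_union_genericMatrix_eq_equivariants,
    (range_evalGenericTrace n e f).trans traceAlgebra_genericMonoid_eq_invariants,
    (traceAlgebra_genericMonoid n e f).symm.trans traceAlgebra_genericMonoid_eq_invariants,
    adjoin_trace_union_genericMatrix_eq_equivariants⟩
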